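/- **Theorem (the key technical theorem).** A *Weil diagram* is a finite graph with vertices of degree 1 and 3 (multiple edges, loops, edges joining two degree 1 vertices, and the empty diagram are allowed), with a cyclic order of the incident half-edges at each trivalent vertex, whose degree 1 vertices (*legs*) are linearly ordered, each of grade 1 or 2. Its *leg-grade* is the sum of the grades of its legs. Let $\widetilde{\mathcal W}^i$ be the $\mathbb Q$-vector space generated by isomorphism classes of Weil diagrams of leg-grade $i$ modulo the AS (antisymmetry) and IHX (Jacobi) relations ($\widetilde{\mathcal W}^i=0$ for $i<0$), and let $\mathcal W^i$ be its quotient by the relations that transposing two adjacent legs of grades $x,y$ gives the sign $(-1)^{xy}$. Let $\widetilde{\mathcal W}^i_\iota$, $\mathcal W^i_\iota$ be the same spaces built from diagrams with exactly one additional special degree 1 vertex, which is neither ordered nor graded. Define: * $d:\widetilde{\mathcal W}^i\to\widetilde{\mathcal W}^{i+1}$ and $d_\iota:\widetilde{\mathcal W}^i_\iota\to\widetilde{\mathcal W}^{i+1}_\iota$: the sum over the legs of grade 1 of the diagram in which this leg is given grade 2, with the sign $(-1)^{m}$, $m$ being the total grade of the legs to its left; * $\iota:\widetilde{\mathcal W}^i\to\widetilde{\mathcal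 W}^{i-1}_\iota$: the sum over all legs, with the same signs, of the diagram in which this leg, if of grade 1, becomes the special vertex, and, if of grade 2, is replaced by a trivalent vertex joined to the special vertex and to a new leg of grade 1 in the same position, with the cyclic order (old edge, special vertex, new leg); * $\tau:\widetilde{\mathcal W}\to\mathcal W$, $\tau_\iota:\widetilde{\mathcal W}_\iota\to\mathcal W_\iota$: the quotient maps (forgetting the order of the legs); * $\chi_{\mathcal W}:\mathcal W\to\widetilde{\mathcal W}$, $\chi_{\mathcal W,\iota}:\mathcal W_\iota\to\widetilde{\mathcal W}_\iota$: graded averaging, $D\mapsto\frac1{n!}\sum_{\sigma\in\Sigma_n}\pm\,\sigma D$ for a diagram $D$ with $n$ legs, the sign being the product of $(-1)^{xy}$ over all pairs of legs, of grades $x,y$, whose order is reversed by $\sigma$. Then $(\widetilde{\mathcal W},\widetilde{\mathcal W}_\iota,\iota)$ is an $\iota$-complex, that is, $d^2=0$, $d_\iota^2=0$ and $\iota d=-d_\iota\iota$; the pairs $(\mathrm{id},\mathrm{id})$ and $(\chi_{\mathcal W}\circ\tau,\ \chi_{\mathcal W,\iota}\circ\tau_\iota)$ are maps of $\iota$-complexes,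 that is, degree 0 maps that commute with $d$, $d_\iota$ and $\iota$; and there is an $\iota$-chain homotopy between them: there are linear maps $s:\widetilde{\mathcal W}^i\to\widetilde{\mathcal W}^{i-1}$ and $s_\iota:\widetilde{\mathcal W}^i_\iota\to\widetilde{\mathcal W}^{i-1}_\iota$, for all $i$, with $$d s+s d=\mathrm{id}-\chi_{\mathcal W}\circ\tau,\qquad d_\iota s_\iota+s_\iota d_\iota=\mathrm{id}-\chi_{\mathcal W,\iota}\circ\tau_\iota,\qquad s_\iota\,\iota+\iota\, s=0.$$ Consequently, if $z\in\widetilde{\mathcal W}^i$ satisfies $\iota z=0$ and $dz=0$, then $\chi_{\mathcal W}(\tau(z))$ also satisfies these equations, and there is $x\in\widetilde{\mathcal W}^{i-1}$ with $\iota x=0$ and $z-\chi_{\mathcal W}(\tau(z))=dx$. -/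

import Mathlib

noncomputable section

namespace Weil

/-! ### Diagrams -/

/-- A partition of a set `H` of half-edges into pairs (the edges), given as a fixed-point-free
involution: `P.other h` is the second half of the edge that contains `h`. -/
@[ext] structure Pairing (H : Type) where
  other : H → H
  other_other : ∀ h, other (other h) = h
  other_ne : ∀ h, other h ≠ h

namespace Pairing

/-- Transport of a pairing along a bijection of the sets of half-edges. -/
def map {H H' : Type} (P : Pairing H) (e : H ≃ H') : Pairing H' where
  other h := e (P.other (e.symm h))
  other_other h := by simp [P.other_other]
  other_ne h hh := P.other_ne (e.symm h) (by simpa using congrArg e.symm hh)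

/-- Disjoint union of pairings. -/
def sum {H H' : Type} (P : Pairing H) (Q : Pairing H') : Pairing (H ⊕ H') where
  other := Sum.map P.other Q.other
  other_other h := by cases h <;> simp [P.other_other, Q.other_other]
  other_ne h := by cases h <;> simp [P.other_ne, Q.other_ne]

/-- A single edge, with the two halves `false` and `true`. -/
def edge : Pairing Bool where
  other := not
  other_other := by simp
  other_ne := by simp

theorem map_map {H H' H'' : Type} (P : Pairing H) (e : H ≃ H') (f : H' ≃ H'') :
    (P.map e).map f = P.map (e.trans f) := rfl

end Pairing

/-- A leg is of grade 1 or of grade 2. -/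
inductive LegGrade where
  | one
  | two
  deriving DecidableEq

/-- The grade of a leg as a number. -/
def LegGrade.val : LegGrade → ℕ
  | one => 1
  | two => 2

/-- The half-edges of a diagram with `n` legs, a set `S` of special degree 1 vertices, and `v`
trivalent vertices: one at each degree 1 vertex, and three, `(u, 0), (u, 1), (u, 2)`, at each
trivalent vertex `u`. -/
abbrev HalfEdge (S : Type) (n v : ℕ) : Type := (Fin n ⊕ S) ⊕ (Fin v × Fin 3)

/-- A Weil diagram with set `S` of special degree 1 vertices (`S = Empty`: an ordinary Weil
diagram; `S = Unit`: a Weil diagram with precisely one special degree 1 vertex), with names chosen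
for its trivalent vertices. The legs are numbered from left to right along the orienting line. The
orientation of a trivalent vertex `u` is the cyclic order `(u, 0) → (u, 1) → (u, 2) → (u, 0)`.
Multiple edges, loops, several components, edges that join two degree 1 vertices, and the empty
diagram are allowed. -/
structure WeilDiagram (S : Type) where
  /-- number of legs -/
  n : ℕ
  /-- grades of the legs -/
  grade : Fin n → LegGrade
  /-- number of trivalent vertices -/
  v : ℕ
  /-- the edges -/
  edges : Pairing (HalfEdge S n v)

/-- Acting on the half-edges at trivalent vertices and on nothing else. -/
def innerEquiv (S : Type) (n : ℕ) {v : ℕ} (π : Equiv.Perm (Fin v × Fin 3)) :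
    HalfEdge S n v ≃ HalfEdge S n v :=
  Equiv.sumCongr (Equiv.refl _) π

namespace WeilDiagram

variable {S : Type}

/-- The leg-grade: the total grade of the legs. -/
def legGrade (D : WeilDiagram S) : ℕ := ∑ i, (D.grade i).val

/-- Whatever is attached to the slot `x` of a trivalent vertex is re-attached to the slot `π x`. -/
def move (D : WeilDiagram S) (π : Equiv.Perm (Fin D.v × Fin 3)) : WeilDiagram S where
  n := D.n
  grade := D.grade
  v := D.v
  edges := D.edges.map (innerEquiv S D.n π)

/-- Move the leg at position `p` of the orienting line to position `σ p`, for every `p`. -/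
def permuteLegs (D : WeilDiagram S) (σ : Equiv.Perm (Fin D.n)) : WeilDiagram S where
  n := D.n
  grade := D.grade ∘ σ.symm
  v := D.v
  edges := D.edges.map
    (Equiv.sumCongr (Equiv.sumCongr σ (Equiv.refl S)) (Equiv.refl (Fin D.v × Fin 3)))

/-- Change the grade of the leg `i` to 2. -/
def raiseLeg (D : WeilDiagram S) (i : Fin D.n) : WeilDiagram S where
  n := D.n
  grade := Function.update D.grade i LegGrade.two
  v := D.v
  edges := D.edges

end WeilDiagram

/-- Renaming the trivalent vertices by `ρ`, and turning the half-edges at the vertex `u` cyclically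
by `r u` steps. Two Weil diagrams are isomorphic (respecting orientations at trivalent vertices and
the order and the grades of the legs) exactly when they differ by such a permutation. -/
def isoPerm {v : ℕ} (ρ : Equiv.Perm (Fin v)) (r : Fin v → Fin 3) :
    Equiv.Perm (Fin v × Fin 3) where
  toFun x := (ρ x.1, x.2 + r x.1)
  invFun x := (ρ.symm x.1, x.2 - r (ρ.symm x.1))
  left_inv x := by simp
  right_inv x := by simp

/-- Reversing the orientation at the trivalent vertex `u`. -/
def asPerm {v : ℕ} (u : Fin v) : Equiv.Perm (Fin v × Fin 3) :=
  Equiv.swap (u, 0) (u, 1)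

/-- The cyclic permutation `(u, 0) → (u, 1) → (w, 1) → (u, 0)` (for `u ≠ w`). -/
def ihxPerm {v : ℕ} (u w : Fin v) : Equiv.Perm (Fin v × Fin 3) :=
  Equiv.swap (u, 0) (u, 1) * Equiv.swap (u, 1) (w, 1)

/-- Formal finite `ℚ`-linear combinations of Weil diagrams. -/
abbrev Formal (S : Type) : Type := WeilDiagram S →₀ ℚ

/-- A Weil diagram as a formal linear combination. -/
def gen {S : Type} (D : WeilDiagram S) : Formal S := Finsupp.single D 1

/-- The relations that do not affect the legs.
* `iso`: isomorphic diagrams are identified.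
* `as`: reversing the orientation of a trivalent vertex changes the sign (so that a diagram with a
  loop vanishes).
* `ihx`: for an edge between two different trivalent vertices `u` and `w`, made of the half-edges
  `(u, 2)` and `(w, 0)`: with `a, b, c, e` attached to `(u, 0), (u, 1), (w, 1), (w, 2)` the sum of
  the three diagrams obtained by cyclic permutations of `a, b, c` vanishes. -/
inductive DiagramRel (S : Type) : Formal S → Prop
  | iso (D : WeilDiagram S) (ρ : Equiv.Perm (Fin D.v)) (r : Fin D.v → Fin 3) :
      DiagramRel S (gen D - gen (D.move (isoPerm ρ r)))
  | as (D : WeilDiagram S) (u : Fin D.v) :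
      DiagramRel S (gen D + gen (D.move (asPerm u)))
  | ihx (D : WeilDiagram S) (u w : Fin D.v) (huw : u ≠ w)
      (hedge : D.edges.other (Sum.inr (u, 2)) = Sum.inr (w, 0)) :
      DiagramRel S (gen D + gen (D.move (ihxPerm u w)) + gen (D.move (ihxPerm u w)⁻¹))

/-- The Perm relations: when two neighbouring legs, of grades `x` and `y`, are transposed,
the sign `(-1) ^ (x y)` appears. -/
inductive PermRel (S : Type) : Formal S → Prop
  | perm (D : WeilDiagram S) (i j : Fin D.n) (hij : i.val + 1 = j.val) :
      PermRel S (gen D -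
        (-1 : ℚ) ^ ((D.grade i).val * (D.grade j).val) • gen (D.permuteLegs (Equiv.swap i j)))

def ncRelations (S : Type) : Submodule ℚ (Formal S) :=
  Submodule.span ℚ {x | DiagramRel S x}

def commRelations (S : Type) : Submodule ℚ (Formal S) :=
  Submodule.span ℚ {x | DiagramRel S x ∨ PermRel S x}

/-- The total space of the non-commutative Weil complex (`S = Empty`), and its version for
diagrams with one special vertex (`S = Unit`). -/
abbrev NCWeil (S : Type) : Type := Formal S ⧸ ncRelations S

/-- The total space of the commutative Weil complex (`S = Empty`), and its version for
diagrams with one special vertex (`S = Unit`). -/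
abbrev CommWeil (S : Type) : Type := Formal S ⧸ commRelations S

/-- The class of a diagram in the non-commutative Weil complex. -/
def ncMk {S : Type} (D : WeilDiagram S) : NCWeil S := (ncRelations S).mkQ (gen D)

/-- The class of a diagram in the commutative Weil complex. -/
def commMk {S : Type} (D : WeilDiagram S) : CommWeil S := (commRelations S).mkQ (gen D)

/-- The part of leg-grade `i` (it is zero for negative `i`). -/
def ncGr (S : Type) (i : ℤ) : Submodule ℚ (NCWeil S) :=
  Submodule.span ℚ {x | ∃ D : WeilDiagram S, (D.legGrade : ℤ) = i ∧ ncMk D = x}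

theorem ncMk_iso {S : Type} (D : WeilDiagram S) (ρ : Equiv.Perm (Fin D.v)) (r : Fin D.v → Fin 3) :
    ncMk D - ncMk (D.move (isoPerm ρ r)) = 0 := by
  unfold ncMk
  rw [← map_sub, Submodule.mkQ_apply, Submodule.Quotient.mk_eq_zero]
  exact Submodule.subset_span (DiagramRel.iso D ρ r)

theorem ncMk_as {S : Type} (D : WeilDiagram S) (u : Fin D.v) :
    ncMk D + ncMk (D.move (asPerm u)) = 0 := by
  unfold ncMk
  rw [← map_add, Submodule.mkQ_apply, Submodule.Quotient.mk_eq_zero]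
  exact Submodule.subset_span (DiagramRel.as D u)

theorem ncMk_ihx {S : Type} (D : WeilDiagram S) (u w : Fin D.v) (huw : u ≠ w)
    (hedge : D.edges.other (Sum.inr (u, 2)) = Sum.inr (w, 0)) :
    ncMk D + ncMk (D.move (ihxPerm u w)) + ncMk (D.move (ihxPerm u w)⁻¹) = 0 := by
  unfold ncMk
  rw [← map_add, ← map_add, Submodule.mkQ_apply, Submodule.Quotient.mk_eq_zero]
  exact Submodule.subset_span (DiagramRel.ihx D u w huw hedge)

/-- The linear extension of a map that is given on diagrams. -/
def ext {S : Type} {M : Type} [AddCommGroup M] [Module ℚ M] (F : WeilDiagram S → M) :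
    Formal S →ₗ[ℚ] M := Finsupp.linearCombination ℚ F

@[simp] theorem ext_gen {S : Type} {M : Type} [AddCommGroup M] [Module ℚ M]
    (F : WeilDiagram S → M) (D : WeilDiagram S) : ext F (gen D) = F D := by
  simp [ext, gen]

/-! ### Formal linear differential operators of odd degree -/

/-- The sign that an operator of odd degree acquires on its way from the left end of the
orienting line to the leg `i`. -/
def legSign {n : ℕ} (g : Fin n → LegGrade) (i : Fin n) : ℚ :=
  (-1) ^ (∑ j ∈ Finset.Iio i, (g j).val)

/-- The differential on diagrams: a leg of grade 1 is replaced by a leg of grade 2,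
and a leg of grade 2 by zero. -/
def dGen {S : Type} (D : WeilDiagram S) : NCWeil S :=
  ∑ i, if D.grade i = LegGrade.one then legSign D.grade i • ncMk (D.raiseLeg i) else 0

theorem dGen_rel {S : Type} (x : Formal S) (hx : DiagramRel S x) : ext dGen x = 0 := by
  cases hx with
  | iso D ρ r =>
    rw [map_sub, ext_gen, ext_gen]
    unfold dGen
    rw [sub_eq_zero]
    refine Finset.sum_congr rfl fun i _ => ?_
    change (if D.grade i = LegGrade.one then _ else _)
      = (if D.grade i = LegGrade.one then _ else _)
    split_ifs
    · have := sub_eq_zero.1 (ncMk_iso (D.raiseLeg i) ρ r)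
      rw [this]; rfl
    · rfl
  | as D u =>
    rw [map_add, ext_gen, ext_gen]
    unfold dGen
    change ∑ i : Fin D.n, _ + ∑ i : Fin D.n, _ = _
    rw [← Finset.sum_add_distrib]
    refine Finset.sum_eq_zero fun i _ => ?_
    change (if D.grade i = LegGrade.one then legSign D.grade i • ncMk (D.raiseLeg i) else 0)
      + (if D.grade i = LegGrade.one then
        legSign D.grade i • ncMk ((D.raiseLeg i).move (asPerm u)) else 0) = 0
    split_ifs
    · rw [← smul_add, ncMk_as (D.raiseLeg i) u, smul_zero]
    · simp
  | ihx D u w huw hedge =>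
    rw [map_add, map_add, ext_gen, ext_gen, ext_gen]
    unfold dGen
    change ∑ i : Fin D.n, _ + ∑ i : Fin D.n, _ + ∑ i : Fin D.n, _ = _
    rw [← Finset.sum_add_distrib, ← Finset.sum_add_distrib]
    refine Finset.sum_eq_zero fun i _ => ?_
    change (if D.grade i = LegGrade.one then legSign D.grade i • ncMk (D.raiseLeg i) else 0)
      + (if D.grade i = LegGrade.one then
        legSign D.grade i • ncMk ((D.raiseLeg i).move (ihxPerm u w)) else 0)
      + (if D.grade i = LegGrade.one then
        legSign D.grade i • ncMk ((D.raiseLeg i).move (ihxPerm u w)⁻¹) else 0) = 0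
    split_ifs
    · rw [← smul_add, ← smul_add, ncMk_ihx (D.raiseLeg i) u w huw hedge, smul_zero]
    · simp

/-- The differential of the non-commutative Weil complex. -/
def ncD (S : Type) : NCWeil S →ₗ[ℚ] NCWeil S :=
  (ncRelations S).liftQ (ext dGen) (Submodule.span_le.2 dGen_rel)

/-- Turn the leg `i` into the special vertex. -/
def specialEquiv {n : ℕ} (v : ℕ) (i : Fin (n + 1)) :
    HalfEdge Empty (n + 1) v ≃ HalfEdge Unit n v :=
  Equiv.sumCongr ((Equiv.sumEmpty _ _).trans
    ((finSuccEquiv' i).trans (Equiv.optionEquivSumPUnit _))) (Equiv.refl _)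

/-- The half-edges of a diagram, together with two new edges, are identified with the half-edges
of the diagram that results when a fork is glued to the leg `i`. The new trivalent vertex is the
last one. Its slot 0 takes the place that the leg `i` had; its slot 1 is joined to the special
vertex (first new edge); its slot 2 is joined to a new leg at position `i` (second new edge). -/
def forkEquiv {n : ℕ} (v : ℕ) (i : Fin n) :
    HalfEdge Empty n v ⊕ (Bool ⊕ Bool) ≃ HalfEdge Unit n (v + 1) where
  toFun
    | Sum.inl (Sum.inl (Sum.inl j)) =>
        if j = i then Sum.inr (Fin.last v, 0) else Sum.inl (Sum.inl j)
    | Sum.inl (Sum.inr (u, c)) => Sum.inr (u.castSucc, c)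
    | Sum.inr (Sum.inl false) => Sum.inl (Sum.inr ())
    | Sum.inr (Sum.inl true) => Sum.inr (Fin.last v, 1)
    | Sum.inr (Sum.inr false) => Sum.inl (Sum.inl i)
    | Sum.inr (Sum.inr true) => Sum.inr (Fin.last v, 2)
  invFun
    | Sum.inl (Sum.inl j) =>
        if j = i then Sum.inr (Sum.inr false) else Sum.inl (Sum.inl (Sum.inl j))
    | Sum.inl (Sum.inr _) => Sum.inr (Sum.inl false)
    | Sum.inr (u, c) =>
        Fin.lastCases (motive := fun _ => HalfEdge Empty n v ⊕ (Bool ⊕ Bool))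
          (match c with
            | 0 => Sum.inl (Sum.inl (Sum.inl i))
            | 1 => Sum.inr (Sum.inl true)
            | 2 => Sum.inr (Sum.inr true))
          (fun u' => Sum.inl (Sum.inr (u', c))) u
  left_inv := by
    rintro (((j | j) | ⟨u, c⟩) | ((_ | _) | (_ | _)))
    · by_cases h : j = i
      · subst h; simp
      · simp [h]
    · exact j.elim
    · simp
    · simp
    · simp
    · simp
    · simp
  right_inv := by
    rintro ((j | j) | ⟨u, c⟩)
    · by_cases h : j = i
      · subst h; simp
      · simp [h]
    · simp
    · induction u using Fin.lastCases with
      | last => fin_cases c <;> simp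
      | cast u => simp

/-- Turn the leg `i` into the special vertex; the other legs keep their order. -/
def legToSpecial {n : ℕ} (g : Fin (n + 1) → LegGrade) (v : ℕ)
    (P : Pairing (HalfEdge Empty (n + 1) v)) (i : Fin (n + 1)) : WeilDiagram Unit where
  n := n
  grade := g ∘ i.succAbove
  v := v
  edges := P.map (specialEquiv v i)

/-- Glue to the leg `i` a fork whose ends are the special vertex and a leg of grade 1. -/
def legToFork {n : ℕ} (g : Fin n → LegGrade) (v : ℕ)
    (P : Pairing (HalfEdge Empty n v)) (i : Fin n) : WeilDiagram Unit where
  n := n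
  grade := Function.update g i LegGrade.one
  v := v + 1
  edges := (P.sum (Pairing.edge.sum Pairing.edge)).map (forkEquiv v i)

/-- The map `ι` on diagrams: a leg of grade 1 becomes the special vertex, and a leg of grade 2
becomes a fork that ends in the special vertex and a leg of grade 1. -/
def iotaGen : WeilDiagram Empty → NCWeil Unit
  | ⟨0, _, _, _⟩ => 0
  | ⟨_ + 1, g, v, P⟩ => ∑ i, legSign g i •
      match g i with
      | LegGrade.one => ncMk (legToSpecial g v P i)
      | LegGrade.two => ncMk (legToFork g v P i)

theorem legToSpecial_move {n : ℕ} (g : Fin (n + 1) → LegGrade) (v : ℕ)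
    (P : Pairing (HalfEdge Empty (n + 1) v)) (i : Fin (n + 1))
    (π : Equiv.Perm (Fin v × Fin 3)) :
    legToSpecial g v (P.map (innerEquiv Empty (n + 1) π)) i = (legToSpecial g v P i).move π := by
  simp only [legToSpecial, WeilDiagram.move, Pairing.map_map]
  congr 2
  ext x
  rcases x with x | x <;> simp [innerEquiv, specialEquiv]

theorem legToFork_move {n : ℕ} (g : Fin n → LegGrade) (v : ℕ)
    (P : Pairing (HalfEdge Empty n v)) (i : Fin n)
    (π : Equiv.Perm (Fin v × Fin 3)) (π' : Equiv.Perm (Fin (v + 1) × Fin 3))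
    (h₁ : ∀ u c, π' (Fin.castSucc u, c) = ((π (u, c)).1.castSucc, (π (u, c)).2))
    (h₂ : ∀ c, π' (Fin.last v, c) = (Fin.last v, c)) :
    legToFork g v (P.map (innerEquiv Empty n π)) i = (legToFork g v P i).move π' := by
  have key : (P.map (innerEquiv Empty n π)).sum (Pairing.edge.sum Pairing.edge)
      = (P.sum (Pairing.edge.sum Pairing.edge)).map
          (Equiv.sumCongr (innerEquiv Empty n π) (Equiv.refl _)) := by
    ext x
    rcases x with x | x <;> simp [Pairing.sum, Pairing.map]
  simp only [legToFork, WeilDiagram.move, key, Pairing.map_map]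
  congr 2
  ext x
  rcases x with ((j | j) | ⟨u, c⟩) | ((_ | _) | (_ | _))
  · by_cases h : j = i <;> simp [innerEquiv, forkEquiv, h, h₂]
  · exact j.elim
  · simp [innerEquiv, forkEquiv, h₁]
  · simp [innerEquiv, forkEquiv]
  · simp [innerEquiv, forkEquiv, h₂]
  · simp [innerEquiv, forkEquiv]
  · simp [innerEquiv, forkEquiv, h₂]

theorem swap_castSucc {v : ℕ} (a b : Fin v × Fin 3) (u : Fin v) (c : Fin 3) :
    Equiv.swap (a.1.castSucc, a.2) (b.1.castSucc, b.2) (u.castSucc, c)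
      = ((Equiv.swap a b (u, c)).1.castSucc, (Equiv.swap a b (u, c)).2) := by
  have hinj : Function.Injective (fun x : Fin v × Fin 3 => (x.1.castSucc, x.2)) := by
    rintro ⟨x, y⟩ ⟨x', y'⟩ h
    simpa using h
  exact hinj.swap_apply a b (u, c)

theorem swap_last {v : ℕ} (a b : Fin v × Fin 3) (c : Fin 3) :
    Equiv.swap (a.1.castSucc, a.2) (b.1.castSucc, b.2) (Fin.last v, c) = (Fin.last v, c) :=
  Equiv.swap_apply_of_ne_of_ne
    (fun h => Fin.castSucc_ne_last a.1 (congrArg Prod.fst h).symm)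
    (fun h => Fin.castSucc_ne_last b.1 (congrArg Prod.fst h).symm)

theorem legToFork_as {n : ℕ} (g : Fin n → LegGrade) (v : ℕ)
    (P : Pairing (HalfEdge Empty n v)) (i : Fin n) (u : Fin v) :
    legToFork g v (P.map (innerEquiv Empty n (asPerm u))) i
      = (legToFork g v P i).move (asPerm u.castSucc) :=
  legToFork_move g v P i _ _ (fun x c => swap_castSucc (u, 0) (u, 1) x c)
    (fun c => swap_last (u, 0) (u, 1) c)

theorem ihxPerm_castSucc {v : ℕ} (u w x : Fin v) (c : Fin 3) :
    ihxPerm u.castSucc w.castSucc (x.castSucc, c)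
      = ((ihxPerm u w (x, c)).1.castSucc, (ihxPerm u w (x, c)).2) := by
  simp only [ihxPerm, Equiv.Perm.mul_apply]
  rw [swap_castSucc (u, 1) (w, 1), swap_castSucc (u, 0) (u, 1)]

theorem ihxPerm_last {v : ℕ} (u w : Fin v) (c : Fin 3) :
    ihxPerm u.castSucc w.castSucc (Fin.last v, c) = (Fin.last v, c) := by
  simp only [ihxPerm, Equiv.Perm.mul_apply]
  rw [swap_last (u, 1) (w, 1), swap_last (u, 0) (u, 1)]

theorem legToFork_ihx {n : ℕ} (g : Fin n → LegGrade) (v : ℕ)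
    (P : Pairing (HalfEdge Empty n v)) (i : Fin n) (u w : Fin v) :
    legToFork g v (P.map (innerEquiv Empty n (ihxPerm u w))) i
      = (legToFork g v P i).move (ihxPerm u.castSucc w.castSucc) :=
  legToFork_move g v P i _ _ (ihxPerm_castSucc u w) (ihxPerm_last u w)

theorem legToFork_ihx_inv {n : ℕ} (g : Fin n → LegGrade) (v : ℕ)
    (P : Pairing (HalfEdge Empty n v)) (i : Fin n) (u w : Fin v) :
    legToFork g v (P.map (innerEquiv Empty n (ihxPerm u w)⁻¹)) i
      = (legToFork g v P i).move (ihxPerm u.castSucc w.castSucc)⁻¹ := by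
  have h₁ : ∀ (x : Fin v) (c : Fin 3), (ihxPerm u.castSucc w.castSucc)⁻¹ (x.castSucc, c)
      = (((ihxPerm u w)⁻¹ (x, c)).1.castSucc, ((ihxPerm u w)⁻¹ (x, c)).2) := by
    intro x c
    rw [Equiv.Perm.inv_eq_iff_eq, ihxPerm_castSucc]
    simp
  have h₂ : ∀ c : Fin 3, (ihxPerm u.castSucc w.castSucc)⁻¹ (Fin.last v, c) = (Fin.last v, c) := by
    intro c
    rw [Equiv.Perm.inv_eq_iff_eq, ihxPerm_last]
  exact legToFork_move g v P i _ _ h₁ h₂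

theorem legToFork_iso {n : ℕ} (g : Fin n → LegGrade) (v : ℕ)
    (P : Pairing (HalfEdge Empty n v)) (i : Fin n) (ρ : Equiv.Perm (Fin v)) (r : Fin v → Fin 3) :
    ∃ (ρ' : Equiv.Perm (Fin (v + 1))) (r' : Fin (v + 1) → Fin 3),
      legToFork g v (P.map (innerEquiv Empty n (isoPerm ρ r))) i
        = (legToFork g v P i).move (isoPerm ρ' r') := by
  have h₁ : ∀ ρ : Equiv.Perm (Fin v), Function.LeftInverse
      (fun x => Fin.lastCases (motive := fun _ => Fin (v + 1)) (Fin.last v)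
        (fun y => (ρ.symm y).castSucc) x)
      (fun x => Fin.lastCases (motive := fun _ => Fin (v + 1)) (Fin.last v)
        (fun y => (ρ y).castSucc) x) := by
    intro ρ x
    induction x using Fin.lastCases <;> simp
  let ρ' : Equiv.Perm (Fin (v + 1)) := ⟨_, _, h₁ ρ, h₁ ρ.symm⟩
  let r' : Fin (v + 1) → Fin 3 := fun x => Fin.lastCases (motive := fun _ => Fin 3) 0 r x
  refine ⟨ρ', r', legToFork_move g v P i _ _ (fun x c => ?_) (fun c => ?_)⟩
  · change (ρ' x.castSucc, c + r' x.castSucc) = ((ρ x).castSucc, c + r x)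
    simp [ρ', r']
  · change (ρ' (Fin.last v), c + r' (Fin.last v)) = (Fin.last v, c)
    simp [ρ', r']

theorem iotaGen_rel (x : Formal Empty) (hx : DiagramRel Empty x) : ext iotaGen x = 0 := by
  cases hx with
  | iso D ρ r =>
    rw [map_sub, ext_gen, ext_gen, sub_eq_zero]
    obtain ⟨n, g, v, P⟩ := D
    cases n with
    | zero => rfl
    | succ n =>
      refine Finset.sum_congr rfl fun i _ => ?_
      cases h : g i with
      | one =>
        simp only [WeilDiagram.move, h, legToSpecial_move]
        exact congrArg _ (sub_eq_zero.1 (ncMk_iso (legToSpecial g v P i) ρ r))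
      | two =>
        obtain ⟨ρ', r', h'⟩ := legToFork_iso g v P i ρ r
        simp only [WeilDiagram.move, h, h']
        exact congrArg _ (sub_eq_zero.1 (ncMk_iso (legToFork g v P i) ρ' r'))
  | as D u =>
    rw [map_add, ext_gen, ext_gen]
    obtain ⟨n, g, v, P⟩ := D
    cases n with
    | zero => exact add_zero 0
    | succ n =>
      simp only [iotaGen, WeilDiagram.move]
      rw [← Finset.sum_add_distrib]
      refine Finset.sum_eq_zero fun i _ => ?_
      cases h : g i with
      | one =>
        simp only [legToSpecial_move]
        rw [← smul_add]
        exact (congrArg _ (ncMk_as (legToSpecial g v P i) u)).trans (smul_zero _)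
      | two =>
        simp only [legToFork_as]
        rw [← smul_add]
        exact (congrArg _ (ncMk_as (legToFork g v P i) u.castSucc)).trans (smul_zero _)
  | ihx D u w huw hedge =>
    rw [map_add, map_add, ext_gen, ext_gen, ext_gen]
    obtain ⟨n, g, v, P⟩ := D
    cases n with
    | zero => simp [iotaGen, WeilDiagram.move]
    | succ n =>
      simp only [iotaGen, WeilDiagram.move]
      rw [← Finset.sum_add_distrib, ← Finset.sum_add_distrib]
      refine Finset.sum_eq_zero fun i _ => ?_
      simp only at hedge
      cases h : g i with
      | one =>
        simp only [legToSpecial_move]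
        rw [← smul_add, ← smul_add]
        refine (congrArg _ (ncMk_ihx (legToSpecial g v P i) u w huw ?_)).trans (smul_zero _)
        simp [legToSpecial, Pairing.map, specialEquiv, hedge]
      | two =>
        simp only [legToFork_ihx, legToFork_ihx_inv]
        rw [← smul_add, ← smul_add]
        refine (congrArg _ (ncMk_ihx (legToFork g v P i) u.castSucc w.castSucc
          (fun h => huw (Fin.castSucc_injective v h)) ?_)).trans (smul_zero _)
        simp [legToFork, Pairing.map, Pairing.sum, forkEquiv, hedge]

/-- The map `ι` of the non-commutative Weil complex. -/
def ncIota : NCWeil Empty →ₗ[ℚ] NCWeil Unit :=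
  (ncRelations Empty).liftQ (ext iotaGen) (Submodule.span_le.2 iotaGen_rel)

/-! ### Forgetting the order, and graded averaging -/

/-- The forget-the-ordering map. -/
def tau (S : Type) : NCWeil S →ₗ[ℚ] CommWeil S :=
  (ncRelations S).mapQ (commRelations S) LinearMap.id
    (Submodule.span_mono fun _ hx => Or.inl hx)

/-- The sign of the rearrangement `σ` of legs with grades `g`: every pair of legs whose order is
reversed contributes `(-1) ^ (x y)`, where `x` and `y` are their grades. -/
def koszulSign {n : ℕ} (g : Fin n → LegGrade) (σ : Equiv.Perm (Fin n)) : ℚ :=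
  ∏ p : Fin n, ∏ q : Fin n, if p < q ∧ σ q < σ p then (-1) ^ ((g p).val * (g q).val) else 1

/-- The average of the signed orderings of the legs of a diagram. -/
def chiGen {S : Type} (D : WeilDiagram S) : NCWeil S :=
  (1 / (D.n.factorial : ℚ)) •
    ∑ σ : Equiv.Perm (Fin D.n), koszulSign D.grade σ • ncMk (D.permuteLegs σ)

theorem permuteLegs_move {S : Type} (D : WeilDiagram S) (π : Equiv.Perm (Fin D.v × Fin 3))
    (σ : Equiv.Perm (Fin D.n)) :
    (D.move π).permuteLegs σ = (D.permuteLegs σ).move π := by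
  simp only [WeilDiagram.permuteLegs, WeilDiagram.move, Pairing.map_map]
  congr 2
  ext x
  rcases x with x | x <;> simp [innerEquiv]

theorem permuteLegs_permuteLegs {S : Type} (D : WeilDiagram S) (σ σ' : Equiv.Perm (Fin D.n)) :
    (D.permuteLegs σ).permuteLegs σ' = D.permuteLegs (σ' * σ) := by
  have h : ((Equiv.sumCongr (Equiv.sumCongr σ (Equiv.refl S)) (Equiv.refl (Fin D.v × Fin 3))).trans
      (Equiv.sumCongr (Equiv.sumCongr σ' (Equiv.refl S)) (Equiv.refl (Fin D.v × Fin 3))))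
      = Equiv.sumCongr (Equiv.sumCongr (σ' * σ) (Equiv.refl S)) (Equiv.refl (Fin D.v × Fin 3)) := by
    ext x
    rcases x with (x | x) | x <;> simp
  simp only [WeilDiagram.permuteLegs, Pairing.map_map, h]
  rfl

theorem swap_lt_swap {n : ℕ} (i j : Fin n) (hij : i.val + 1 = j.val) (p q : Fin n) :
    Equiv.swap i j p < Equiv.swap i j q ↔
      (p < q ∧ ¬ (p = i ∧ q = j)) ∨ (p = j ∧ q = i) := by
  simp only [Equiv.swap_apply_def, Fin.lt_def, Fin.ext_iff]
  split_ifs <;> omega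

theorem koszulSign_swap {n : ℕ} (g : Fin n → LegGrade) (i j : Fin n) (hij : i.val + 1 = j.val)
    (σ : Equiv.Perm (Fin n)) :
    koszulSign g (σ * Equiv.swap i j) =
      (-1) ^ ((g i).val * (g j).val) * koszulSign (g ∘ (Equiv.swap i j).symm) σ := by
  have hne : i ≠ j := by
    rintro rfl
    omega
  have hij' : i < j := by
    rw [Fin.lt_def]
    omega
  set e : ℚ := (-1) ^ ((g i).val * (g j).val) with he
  have hee : e * e = 1 := by
    rw [he, ← mul_pow]
    norm_num
  have hR : koszulSign (g ∘ (Equiv.swap i j).symm) σ = ∏ p : Fin n, ∏ q : Fin n,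
      if Equiv.swap i j p < Equiv.swap i j q ∧
        σ (Equiv.swap i j q) < σ (Equiv.swap i j p)
      then (-1 : ℚ) ^ ((g p).val * (g q).val) else 1 := by
    unfold koszulSign
    rw [← Equiv.prod_comp (Equiv.swap i j)]
    refine Finset.prod_congr rfl fun p _ => ?_
    rw [← Equiv.prod_comp (Equiv.swap i j)]
    refine Finset.prod_congr rfl fun q _ => ?_
    simp
  have hC : ∏ p : Fin n, ∏ q : Fin n,
      ((if p = i then (if q = j then (if σ i < σ j then e else 1) else 1) else 1) *
        (if p = j then (if q = i then (if σ j < σ i then e else 1) else 1) else 1)) = e := by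
    have h1 : ∀ (a b : Fin n) (c : ℚ), ∏ p : Fin n, ∏ q : Fin n,
        (if p = a then (if q = b then c else 1) else 1) = c := by
      intro a b c
      rw [Finset.prod_eq_single a, Finset.prod_eq_single b] <;> simp +contextual
    simp only [Finset.prod_mul_distrib, h1]
    rcases lt_trichotomy (σ i) (σ j) with h | h | h
    · simp [h, h.not_gt]
    · exact absurd (σ.injective h) hne
    · simp [h, h.not_gt]
  rw [hR, ← hC, ← Finset.prod_mul_distrib]
  unfold koszulSign
  refine Finset.prod_congr rfl fun p _ => ?_
  rw [← Finset.prod_mul_distrib]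
  refine Finset.prod_congr rfl fun q _ => ?_
  simp only [swap_lt_swap i j hij, Equiv.Perm.mul_apply]
  by_cases h1 : p = i ∧ q = j
  · obtain ⟨rfl, rfl⟩ := h1
    simp [hne, hij', he]
  · by_cases h2 : p = j ∧ q = i
    · obtain ⟨rfl, rfl⟩ := h2
      have : (-1 : ℚ) ^ ((g p).val * (g q).val) = e := by rw [he, mul_comm]
      simp only [this]
      by_cases h3 : σ p < σ q <;> simp [hne, hne.symm, hij'.not_gt, h3, hee]
    · have a1 : (if p = i then (if q = j then (if σ i < σ j then e else 1) else 1) else 1)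
          = (1 : ℚ) := by
        by_cases hp : p = i
        · have : q ≠ j := fun h => h1 ⟨hp, h⟩
          simp [this]
        · simp [hp]
      have a2 : (if p = j then (if q = i then (if σ j < σ i then e else 1) else 1) else 1)
          = (1 : ℚ) := by
        by_cases hp : p = j
        · have : q ≠ i := fun h => h2 ⟨hp, h⟩
          simp [this]
        · simp [hp]
      rw [a1, a2]
      simp only [h1, h2, not_false_eq_true, and_true, or_false, one_mul]
      exact if_congr Iff.rfl rfl rfl

theorem chiGen_move {S : Type} (D : WeilDiagram S) (π : Equiv.Perm (Fin D.v × Fin 3)) :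
    chiGen (D.move π) = (1 / (D.n.factorial : ℚ)) •
      ∑ σ : Equiv.Perm (Fin D.n), koszulSign D.grade σ • ncMk ((D.permuteLegs σ).move π) := by
  refine congrArg ((1 / (D.n.factorial : ℚ)) • ·) (Finset.sum_congr rfl fun σ _ => ?_)
  exact congrArg (fun E => koszulSign D.grade σ • ncMk E) (permuteLegs_move D π σ)

theorem chiGen_rel {S : Type} (x : Formal S) (hx : DiagramRel S x ∨ PermRel S x) :
    ext chiGen x = 0 := by
  rcases hx with (⟨D, ρ, r⟩ | ⟨D, u⟩ | ⟨D, u, w, huw, hedge⟩) | ⟨D, i, j, hij⟩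
  · rw [map_sub, ext_gen, ext_gen, sub_eq_zero, chiGen_move]
    refine congrArg ((1 / (D.n.factorial : ℚ)) • ·) (Finset.sum_congr rfl fun σ _ => ?_)
    exact congrArg _ (sub_eq_zero.1 (ncMk_iso (D.permuteLegs σ) ρ r))
  · rw [map_add, ext_gen, ext_gen, chiGen_move]
    unfold chiGen
    rw [← smul_add, ← Finset.sum_add_distrib, Finset.sum_eq_zero, smul_zero]
    intro σ _
    rw [← smul_add]
    exact (congrArg _ (ncMk_as (D.permuteLegs σ) u)).trans (smul_zero _)
  · rw [map_add, map_add, ext_gen, ext_gen, ext_gen, chiGen_move, chiGen_move]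
    unfold chiGen
    rw [← smul_add, ← smul_add, ← Finset.sum_add_distrib, ← Finset.sum_add_distrib,
      Finset.sum_eq_zero, smul_zero]
    intro σ _
    rw [← smul_add, ← smul_add]
    refine (congrArg _ (ncMk_ihx (D.permuteLegs σ) u w huw ?_)).trans (smul_zero _)
    simp [WeilDiagram.permuteLegs, Pairing.map, hedge]
  · rw [map_sub, map_smul, ext_gen, ext_gen, sub_eq_zero]
    unfold chiGen
    rw [smul_comm]
    refine congrArg _ ?_
    rw [Finset.smul_sum]
    rw [← Equiv.sum_comp (Equiv.mulRight (Equiv.swap i j))]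
    refine Finset.sum_congr rfl fun σ _ => ?_
    rw [permuteLegs_permuteLegs, smul_smul, Equiv.coe_mulRight, koszulSign_swap _ _ _ hij]
    rfl

/-- The graded averaging map. -/
def chi (S : Type) : CommWeil S →ₗ[ℚ] NCWeil S :=
  (commRelations S).liftQ (ext chiGen) (Submodule.span_le.2 chiGen_rel)

/-! ### `ι`-complexes -/

/-- The data of an `ι`-complex: two graded vector spaces with endomorphisms `d`, `dι`, and a
map `ι` from the first to the second. The laws are in `IsIotaComplex`. -/
structure IotaData (K Kι : Type) [AddCommGroup K] [Module ℚ K] [AddCommGroup Kι]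
    [Module ℚ Kι] where
  gr : ℤ → Submodule ℚ K
  grι : ℤ → Submodule ℚ Kι
  d : K →ₗ[ℚ] K
  dι : Kι →ₗ[ℚ] Kι
  ι : K →ₗ[ℚ] Kι

section

variable {K Kι L Lι : Type} [AddCommGroup K] [Module ℚ K] [AddCommGroup Kι] [Module ℚ Kι]
  [AddCommGroup L] [Module ℚ L] [AddCommGroup Lι] [Module ℚ Lι]

/-- The laws of an `ι`-complex: two cochain complexes in non-negative degrees, and a map of
degree `-1` between them that anticommutes with the differentials. -/
structure IsIotaComplex (X : IotaData K Kι) : Prop where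
  internal : DirectSum.IsInternal X.gr
  internal_ι : DirectSum.IsInternal X.grι
  gr_neg : ∀ i < 0, X.gr i = ⊥
  grι_neg : ∀ i < 0, X.grι i = ⊥
  d_mem : ∀ i, ∀ x ∈ X.gr i, X.d x ∈ X.gr (i + 1)
  dι_mem : ∀ i, ∀ x ∈ X.grι i, X.dι x ∈ X.grι (i + 1)
  ι_mem : ∀ i, ∀ x ∈ X.gr i, X.ι x ∈ X.grι (i - 1)
  d_d : X.d ∘ₗ X.d = 0
  dι_dι : X.dι ∘ₗ X.dι = 0
  ι_d : X.ι ∘ₗ X.d = -(X.dι ∘ₗ X.ι)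

/-- `(f, fι)` is a map of `ι`-complexes. -/
structure IsIotaMap (X : IotaData K Kι) (Y : IotaData L Lι) (f : K →ₗ[ℚ] L)
    (fι : Kι →ₗ[ℚ] Lι) : Prop where
  f_mem : ∀ i, ∀ x ∈ X.gr i, f x ∈ Y.gr i
  fι_mem : ∀ i, ∀ x ∈ X.grι i, fι x ∈ Y.grι i
  f_d : f ∘ₗ X.d = Y.d ∘ₗ f
  fι_dι : fι ∘ₗ X.dι = Y.dι ∘ₗ fι
  fι_ι : fι ∘ₗ X.ι = Y.ι ∘ₗ f

/-- `(s, sι)` is an `ι`-chain homotopy between `(f, fι)` and `(g, gι)`. -/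
structure IsIotaHomotopy (X : IotaData K Kι) (Y : IotaData L Lι) (f : K →ₗ[ℚ] L)
    (fι : Kι →ₗ[ℚ] Lι) (g : K →ₗ[ℚ] L) (gι : Kι →ₗ[ℚ] Lι) (s : K →ₗ[ℚ] L)
    (sι : Kι →ₗ[ℚ] Lι) : Prop where
  s_mem : ∀ i, ∀ x ∈ X.gr i, s x ∈ Y.gr (i - 1)
  sι_mem : ∀ i, ∀ x ∈ X.grι i, sι x ∈ Y.grι (i - 1)
  homotopy : Y.d ∘ₗ s + s ∘ₗ X.d = f - g
  homotopy_ι : Y.dι ∘ₗ sι + sι ∘ₗ X.dι = fι - gι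
  sι_ι : sι ∘ₗ X.ι + Y.ι ∘ₗ s = 0

/-- The degree `i` part of the basic subcomplex. -/
def IotaData.basic (X : IotaData K Kι) (i : ℤ) : Submodule ℚ K :=
  X.gr i ⊓ LinearMap.ker X.ι

/-- The degree `i` cocycles of the basic subcomplex. -/
def IotaData.basicCocycles (X : IotaData K Kι) (i : ℤ) : Submodule ℚ K :=
  X.basic i ⊓ LinearMap.ker X.d

/-- The degree `i` coboundaries of the basic subcomplex. -/
def IotaData.basicCoboundaries (X : IotaData K Kι) (i : ℤ) : Submodule ℚ K :=
  (X.basic (i - 1)).map X.d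

end

/-- The non-commutative Weil complex for diagrams. -/
def ncWeil : IotaData (NCWeil Empty) (NCWeil Unit) where
  gr := ncGr Empty
  grι := ncGr Unit
  d := ncD Empty
  dι := ncD Unit
  ι := ncIota

end Weil

end

/-!
The homotopy between the identity and graded averaging comes from a random process that carries the
given order of the legs into a uniformly random one. For a permutation `π` of the legs, let the leg
`p` jump to the right end of the orienting line at the time `π p`. The order before the first jump
is the original one, and the order after the last jump is `π`; `jumpPerm π T` is the order at the
time `T`. The map `homotopy` averages over all `π` and sums, over the legs of grade 2, the
difference of the diagrams before and after the jump of this leg, the leg being given grade 1, with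
the sign of an operator of odd degree.

* `d s + s d`: changes of the grades of two different legs anticommute (`ncD_legOp`), so that only
  the terms survive in which one leg is changed twice. They give the average over `π` of the sum
  over all jumps of "before minus after", which telescopes to `id - χ τ` (`sum_jumpPerm`).
* `s ι + ι s`: again only operations on the same leg matter (`ncIota_legOp`), because deleting a
  leg from a random sequence of jumps leaves a random sequence of jumps of the other legs
  (`delPerm_jumpPerm`, `average_delPerm`). For operations on the same leg, the jumping leg becomes
  the special vertex, and then the orders before and after the jump agree
  (`delPerm_jumpPerm_self`).

Averaging commutes with `d` and `ι` because both are derivations with respect to the signed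
rearrangement of legs (`ncD_signedPerm`, `ncIota_signedPerm`); the underlying identities of Koszul
signs all follow from `legSign_perm` and `koszulSign_delPerm`.

In `ι d + d ι`, the terms that do not cancel in pairs are the diagrams in which the special vertex
is attached to one of the legs, summed over all legs. This sum vanishes (`sum_attachMk_legs`):
attaching the special vertex to the two halves of an edge gives opposite signs by AS, so that the
sum over all half-edges is zero, and the sum over the three half-edges at a trivalent vertex is zero
by IHX.
-/

noncomputable section

namespace Weil

open Finset

/-! ### Deleting elements from permutations, and sequences of jumps -/

/-- A permutation is determined by the linear order that it induces. -/
theorem perm_eq_of_lt_iff {n : ℕ} {σ τ : Equiv.Perm (Fin n)}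
    (h : ∀ p q, σ p < σ q ↔ τ p < τ q) : σ = τ := by
  have h' : StrictMono (σ * τ⁻¹) := by
    intro a b hab
    simp only [Equiv.Perm.mul_apply]
    rw [h]
    simpa using hab
  have h2 : ∀ x, (σ * τ⁻¹) x = x := by
    intro x
    have := Subsingleton.elim
      (StrictMono.orderIsoOfSurjective _ h' (σ * τ⁻¹).surjective) (OrderIso.refl _)
    exact congrArg (fun e : Fin n ≃o Fin n => e x) this
  ext x
  simpa using congrArg Fin.val (h2 (τ x))

/-- The permutation of the remaining legs that `σ` induces when the leg `i` is deleted. -/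
def delPerm {n : ℕ} (σ : Equiv.Perm (Fin (n + 1))) (i : Fin (n + 1)) : Equiv.Perm (Fin n) :=
  (finSuccAboveEquiv i).trans
    ((σ.subtypeEquiv (fun a => by simp)).trans (finSuccAboveEquiv (σ i)).symm)

theorem succAbove_delPerm {n : ℕ} (σ : Equiv.Perm (Fin (n + 1))) (i : Fin (n + 1)) (q : Fin n) :
    (σ i).succAbove (delPerm σ i q) = σ (i.succAbove q) := by
  have := congrArg Subtype.val ((finSuccAboveEquiv (σ i)).apply_symm_apply
    ((σ.subtypeEquiv (p := fun a => a ≠ i) (q := fun a => a ≠ σ i)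
      (fun a => by simp)) (finSuccAboveEquiv i q)))
  exact this

theorem delPerm_lt_iff {n : ℕ} (σ : Equiv.Perm (Fin (n + 1))) (i : Fin (n + 1)) (p q : Fin n) :
    delPerm σ i p < delPerm σ i q ↔ σ (i.succAbove p) < σ (i.succAbove q) := by
  rw [← succAbove_delPerm, ← succAbove_delPerm, Fin.succAbove_lt_succAbove_iff]

theorem delPerm_one {n : ℕ} (i : Fin (n + 1)) : delPerm (1 : Equiv.Perm (Fin (n + 1))) i = 1 :=
  perm_eq_of_lt_iff fun p q => by simp [delPerm_lt_iff]

/-- The permutation that sends `i` to `a` and that induces `ρ` on the other elements. -/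
def insPerm {n : ℕ} (i a : Fin (n + 1)) (ρ : Equiv.Perm (Fin n)) : Equiv.Perm (Fin (n + 1)) :=
  ((finSuccEquiv' i).trans (Equiv.optionCongr ρ)).trans (finSuccEquiv' a).symm

theorem insPerm_self {n : ℕ} (i a : Fin (n + 1)) (ρ : Equiv.Perm (Fin n)) :
    insPerm i a ρ i = a := by
  simp [insPerm]

theorem insPerm_succAbove {n : ℕ} (i a : Fin (n + 1)) (ρ : Equiv.Perm (Fin n)) (q : Fin n) :
    insPerm i a ρ (i.succAbove q) = a.succAbove (ρ q) := by
  simp [insPerm]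

/-- A permutation is determined by the image of `i` and by what it induces on the other
elements. -/
def permEquivDel {n : ℕ} (i : Fin (n + 1)) :
    Equiv.Perm (Fin (n + 1)) ≃ Fin (n + 1) × Equiv.Perm (Fin n) where
  toFun σ := (σ i, delPerm σ i)
  invFun x := insPerm i x.1 x.2
  left_inv σ := by
    refine Equiv.ext fun x => ?_
    rcases Fin.eq_self_or_eq_succAbove i x with rfl | ⟨q, rfl⟩
    · simp [insPerm_self]
    · simp [insPerm_succAbove, succAbove_delPerm]
  right_inv x := by
    refine Prod.ext (insPerm_self _ _ _) (perm_eq_of_lt_iff fun p q => ?_)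
    simp [delPerm_lt_iff, insPerm_succAbove]

/-- Every permutation of `n` elements is obtained from `n + 1` permutations of `n + 1` elements by
deleting `i`. -/
theorem sum_delPerm {n : ℕ} {M : Type*} [AddCommMonoid M] (i : Fin (n + 1))
    (F : Equiv.Perm (Fin n) → M) :
    ∑ σ : Equiv.Perm (Fin (n + 1)), F (delPerm σ i) = (n + 1) • ∑ ρ, F ρ := by
  have h := Equiv.sum_comp (permEquivDel i) (fun x => F x.2)
  rw [Fintype.sum_prod_type] at h
  refine h.trans ?_
  simp

/-- Averages over permutations are compatible with the deletion of a leg. -/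
theorem average_delPerm {n : ℕ} {M : Type*} [AddCommGroup M] [Module ℚ M] (i : Fin (n + 1))
    (F : Equiv.Perm (Fin n) → M) :
    (1 / ((n + 1).factorial : ℚ)) • ∑ σ : Equiv.Perm (Fin (n + 1)), F (delPerm σ i)
      = (1 / (n.factorial : ℚ)) • ∑ ρ, F ρ := by
  rw [sum_delPerm, ← Nat.cast_smul_eq_nsmul ℚ, smul_smul]
  congr 1
  have : (n.factorial : ℚ) ≠ 0 := by positivity
  rw [Nat.factorial_succ]
  push_cast
  field_simp

/-- The key that sorts the legs at the time `T`, when the leg `p` jumps at the time `π p`: the legs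
that have not jumped come first, in the original order, followed by those that have jumped, in the
order of their jumps. -/
def jumpKey {n : ℕ} (π : Equiv.Perm (Fin n)) (T : ℕ) (p : Fin n) : ℕ :=
  if (π p).val < T then n + (π p).val else p.val

theorem jumpKey_injective {n : ℕ} (π : Equiv.Perm (Fin n)) (T : ℕ) :
    Function.Injective (jumpKey π T) := by
  intro p q h
  unfold jumpKey at h
  split_ifs at h
  · exact π.injective (Fin.ext (by omega))
  · omega
  · omega
  · exact Fin.ext h

/-- The rearrangement of the legs reached at the time `T`, when the leg `p` jumps to the right end
of the orienting line at the time `π p`. -/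
def jumpPerm {n : ℕ} (π : Equiv.Perm (Fin n)) (T : ℕ) : Equiv.Perm (Fin n) :=
  (Tuple.sort (jumpKey π T))⁻¹

theorem jumpPerm_lt_iff {n : ℕ} (π : Equiv.Perm (Fin n)) (T : ℕ) (p q : Fin n) :
    jumpPerm π T p < jumpPerm π T q ↔ jumpKey π T p < jumpKey π T q := by
  have h : StrictMono (jumpKey π T ∘ Tuple.sort (jumpKey π T)) :=
    (Tuple.monotone_sort _).strictMono_of_injective
      ((jumpKey_injective π T).comp (Equiv.injective _))
  rw [← h.lt_iff_lt]
  simp [jumpPerm]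

theorem jumpPerm_zero {n : ℕ} (π : Equiv.Perm (Fin n)) : jumpPerm π 0 = 1 :=
  perm_eq_of_lt_iff fun p q => by simp [jumpPerm_lt_iff, jumpKey]

theorem jumpPerm_top {n : ℕ} (π : Equiv.Perm (Fin n)) : jumpPerm π n = π :=
  perm_eq_of_lt_iff fun p q => by simp [jumpPerm_lt_iff, jumpKey]

/-- Jumps of the leg `i` cannot be seen after `i` has been deleted. -/
theorem delPerm_jumpPerm_self {n : ℕ} (π : Equiv.Perm (Fin (n + 1))) (i : Fin (n + 1)) :
    delPerm (jumpPerm π (π i)) i = delPerm (jumpPerm π (π i + 1)) i := by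
  have h : ∀ p, jumpKey π (π i) (i.succAbove p) = jumpKey π (π i + 1) (i.succAbove p) := by
    intro p
    have : (π (i.succAbove p)).val ≠ (π i).val := fun h =>
      Fin.succAbove_ne i p (π.injective (Fin.ext h))
    unfold jumpKey
    refine if_congr ?_ rfl rfl
    omega
  exact perm_eq_of_lt_iff fun p q => by simp only [delPerm_lt_iff, jumpPerm_lt_iff, h]

/-- The jumps of the other legs are not affected by the deletion of `i`. -/
theorem delPerm_jumpPerm {n : ℕ} (π : Equiv.Perm (Fin (n + 1))) (i : Fin (n + 1))
    (T T' : ℕ) (hT : ∀ p, (π (i.succAbove p)).val < T ↔ (delPerm π i p).val < T') :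
    delPerm (jumpPerm π T) i = jumpPerm (delPerm π i) T' := by
  refine perm_eq_of_lt_iff fun p q => ?_
  rw [delPerm_lt_iff, jumpPerm_lt_iff, jumpPerm_lt_iff]
  have h1 := Fin.lt_def.symm.trans ((delPerm_lt_iff π i p q).trans Fin.lt_def)
  have h2 := Fin.lt_def.symm.trans
    ((Fin.succAbove_lt_succAbove_iff (p := i) (i := p) (j := q)).trans Fin.lt_def)
  unfold jumpKey
  simp only [hT]
  have := (i.succAbove p).isLt
  have := (i.succAbove q).isLt
  split_ifs <;> omega

theorem delPerm_jumpPerm_before {n : ℕ} (π : Equiv.Perm (Fin (n + 1))) (i : Fin (n + 1))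
    (j : Fin n) : delPerm (jumpPerm π (π (i.succAbove j))) i
      = jumpPerm (delPerm π i) (delPerm π i j) :=
  delPerm_jumpPerm π i _ _ fun p => (delPerm_lt_iff π i p j).symm

theorem delPerm_jumpPerm_after {n : ℕ} (π : Equiv.Perm (Fin (n + 1))) (i : Fin (n + 1))
    (j : Fin n) : delPerm (jumpPerm π (π (i.succAbove j) + 1)) i
      = jumpPerm (delPerm π i) (delPerm π i j + 1) :=
  delPerm_jumpPerm π i _ _ fun p => by
    have := delPerm_lt_iff π i j p
    simp only [Fin.lt_def] at this
    omega

/-- The jumps lead from the original order of the legs to the order `π`. -/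
theorem sum_jumpPerm {n : ℕ} {M : Type*} [AddCommGroup M] (π : Equiv.Perm (Fin n))
    (F : Equiv.Perm (Fin n) → M) :
    ∑ j, (F (jumpPerm π (π j)) - F (jumpPerm π (π j + 1))) = F 1 - F π := by
  rw [Equiv.sum_comp π (fun k : Fin n => F (jumpPerm π k) - F (jumpPerm π (k + 1))),
    Fin.sum_univ_eq_sum_range (fun k => F (jumpPerm π k) - F (jumpPerm π (k + 1))),
    Finset.sum_range_sub', jumpPerm_zero, jumpPerm_top]

/-! ### Signs -/

theorem legSign_eq_prod {n : ℕ} (g : Fin n → LegGrade) (i : Fin n) :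
    legSign g i = ∏ j, if j < i then (-1 : ℚ) ^ (g j).val else 1 := by
  unfold legSign
  rw [← Finset.prod_pow_eq_pow_sum, ← Finset.prod_filter]
  exact Finset.prod_congr (by ext; simp) fun _ _ => rfl

theorem legSign_mul_self {n : ℕ} (g : Fin n → LegGrade) (i : Fin n) :
    legSign g i * legSign g i = 1 := by
  unfold legSign
  rw [← mul_pow]
  norm_num

theorem legSign_update {n : ℕ} (g : Fin n → LegGrade) (i j : Fin n) (x : LegGrade) :
    legSign (Function.update g i x) j
      = (if i < j then (-1) ^ ((g i).val + x.val) else 1) * legSign g j := by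
  have h : (if i < j then (-1 : ℚ) ^ ((g i).val + x.val) else 1)
      = ∏ k, if k = i then (if i < j then (-1 : ℚ) ^ ((g i).val + x.val) else 1) else 1 := by
    simp
  rw [legSign_eq_prod, legSign_eq_prod, h, ← Finset.prod_mul_distrib]
  refine Finset.prod_congr rfl fun k _ => ?_
  by_cases hk : k = i
  · subst hk
    by_cases hkj : k < j
    · have h1 : ((-1 : ℚ) ^ (g k).val) * (-1 : ℚ) ^ (g k).val = 1 := by
        rw [← mul_pow]; norm_num
      simp only [hkj, if_true, Function.update_self, pow_add]
      linear_combination (-(-1 : ℚ) ^ x.val) * h1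
    · simp [hkj]
  · simp [hk]

theorem legSign_succAbove {n : ℕ} (g : Fin (n + 1) → LegGrade) (i : Fin (n + 1)) (j : Fin n) :
    legSign g (i.succAbove j)
      = (if i < i.succAbove j then (-1) ^ (g i).val else 1) * legSign (g ∘ i.succAbove) j := by
  rw [legSign_eq_prod, legSign_eq_prod, Fin.prod_univ_succAbove _ i]
  simp only [Fin.succAbove_lt_succAbove_iff, Function.comp_apply]

/-- The sign that an element of odd degree acquires when it is moved past all the legs whose
order relative to the leg `i` is reversed by `σ`. -/
def crossSign {n : ℕ} (g : Fin n → LegGrade) (σ : Equiv.Perm (Fin n)) (i : Fin n) : ℚ :=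
  ∏ q, if (i < q ∧ σ q < σ i) ∨ (q < i ∧ σ i < σ q) then (-1) ^ (g q).val else 1

theorem crossSign_mul_self {n : ℕ} (g : Fin n → LegGrade) (σ : Equiv.Perm (Fin n)) (i : Fin n) :
    crossSign g σ i * crossSign g σ i = 1 := by
  unfold crossSign
  rw [← Finset.prod_mul_distrib]
  refine Finset.prod_eq_one fun q _ => ?_
  split_ifs
  · rw [← mul_pow]; norm_num
  · norm_num

theorem crossSign_update {n : ℕ} (g : Fin n → LegGrade) (σ : Equiv.Perm (Fin n)) (i : Fin n)
    (x : LegGrade) : crossSign (Function.update g i x) σ i = crossSign g σ i := by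
  refine Finset.prod_congr rfl fun q _ => ?_
  by_cases h : q = i
  · subst h; simp
  · simp [h]

/-- An operator of odd degree on its way to the leg `i` passes different legs before and after the
rearrangement `σ`: precisely those whose order relative to `i` is reversed. -/
theorem legSign_perm {n : ℕ} (g : Fin n → LegGrade) (σ : Equiv.Perm (Fin n)) (i : Fin n) :
    legSign (g ∘ σ.symm) (σ i) = crossSign g σ i * legSign g i := by
  rw [legSign_eq_prod, legSign_eq_prod, ← Equiv.prod_comp σ]
  unfold crossSign
  rw [← Finset.prod_mul_distrib]
  refine Finset.prod_congr rfl fun q _ => ?_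
  have h1 : ((-1 : ℚ) ^ (g q).val) * (-1 : ℚ) ^ (g q).val = 1 := by
    rw [← mul_pow]; norm_num
  rcases lt_trichotomy q i with h | h | h
  · rcases lt_trichotomy (σ q) (σ i) with h' | h' | h'
    · simp [h, h', h.not_gt, h'.not_gt]
    · exact absurd (σ.injective h') h.ne
    · simp [h, h', h.not_gt, h'.not_gt, h1]
  · subst h; simp
  · rcases lt_trichotomy (σ q) (σ i) with h' | h' | h'
    · simp [h, h', h.not_gt]
    · exact absurd (σ.injective h') h.ne'
    · simp [h, h', h.not_gt, h'.not_gt]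

/-- The pairs that contain the leg `i` contribute `crossSign g σ i ^ (g i).val`, and the other
pairs the sign of what `σ` induces on the other legs. -/
theorem koszulSign_delPerm {n : ℕ} (g : Fin (n + 1) → LegGrade) (σ : Equiv.Perm (Fin (n + 1)))
    (i : Fin (n + 1)) :
    koszulSign g σ = crossSign g σ i ^ (g i).val * koszulSign (g ∘ i.succAbove) (delPerm σ i) := by
  unfold koszulSign crossSign
  simp only [Fin.prod_univ_succAbove _ i]
  simp only [lt_self_iff_false, false_and, or_self, if_false, one_mul]
  rw [Finset.prod_mul_distrib, ← mul_assoc, ← Finset.prod_mul_distrib, ← Finset.prod_pow]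
  congr 1
  · refine Finset.prod_congr rfl fun q _ => ?_
    rcases lt_trichotomy (i.succAbove q) i with h | h | h
    · simp only [h, h.not_gt, false_and, if_false, true_and, one_mul, false_or]
      split_ifs
      · rw [pow_mul]
      · simp
    · exact absurd h (Fin.succAbove_ne i q)
    · simp only [h, h.not_gt, false_and, if_false, true_and, mul_one, or_false]
      split_ifs
      · rw [mul_comm, pow_mul]
      · simp
  · simp only [Fin.succAbove_lt_succAbove_iff, delPerm_lt_iff, Function.comp_apply]

/-- A change of the parity of the leg `i` changes the sign of a rearrangement by `crossSign`. -/
theorem koszulSign_update {n : ℕ} (g : Fin n → LegGrade) (σ : Equiv.Perm (Fin n)) (i : Fin n)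
    (x : LegGrade) :
    koszulSign (Function.update g i x) σ
      = crossSign g σ i ^ ((g i).val + x.val) * koszulSign g σ := by
  cases n with
  | zero => exact i.elim0
  | succ n =>
    rw [koszulSign_delPerm (Function.update g i x) σ i, koszulSign_delPerm g σ i, crossSign_update]
    have h : Function.update g i x ∘ i.succAbove = g ∘ i.succAbove := by
      ext q; simp [Fin.succAbove_ne]
    have h2 : crossSign g σ i ^ (g i).val * crossSign g σ i ^ (g i).val = 1 := by
      rw [← mul_pow, crossSign_mul_self, one_pow]
    rw [h, Function.update_self, pow_add]
    linear_combination (-crossSign g σ i ^ x.val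
      * koszulSign (g ∘ i.succAbove) (delPerm σ i)) * h2

theorem koszulSign_one {n : ℕ} (g : Fin n → LegGrade) : koszulSign g 1 = 1 := by
  unfold koszulSign
  refine Finset.prod_eq_one fun p _ => Finset.prod_eq_one fun q _ => ?_
  rw [if_neg]
  rintro ⟨h, h'⟩
  exact h.not_gt h'

/-! ### Derivations and signed rearrangements -/

theorem ncD_ncMk {S : Type} (D : WeilDiagram S) : ncD S (ncMk D) = dGen D :=
  ext_gen dGen D

theorem ncIota_ncMk (D : WeilDiagram Empty) : ncIota (ncMk D) = iotaGen D :=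
  ext_gen iotaGen D

theorem chi_tau_ncMk {S : Type} (D : WeilDiagram S) : chi S (tau S (ncMk D)) = chiGen D :=
  ext_gen chiGen D

/-- Linear maps on the non-commutative Weil complex agree if they agree on diagrams. -/
theorem ncWeil_hom_ext {S : Type} {M : Type} [AddCommGroup M] [Module ℚ M]
    {f f' : NCWeil S →ₗ[ℚ] M} (h : ∀ D, f (ncMk D) = f' (ncMk D)) : f = f' := by
  refine Submodule.linearMap_qext _ (Finsupp.lhom_ext' fun D => LinearMap.ext_ring ?_)
  exact h D

/-- The diagram with leg grades `g` and edges `P`, with its legs rearranged by `σ`, and with the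
sign of this rearrangement. -/
def signedPerm {S : Type} {n v : ℕ} (g : Fin n → LegGrade) (P : Pairing (HalfEdge S n v))
    (σ : Equiv.Perm (Fin n)) : NCWeil S :=
  koszulSign g σ • ncMk (WeilDiagram.permuteLegs ⟨n, g, v, P⟩ σ)

theorem signedPerm_one {S : Type} {n v : ℕ} (g : Fin n → LegGrade)
    (P : Pairing (HalfEdge S n v)) : signedPerm g P 1 = ncMk ⟨n, g, v, P⟩ := by
  have h : (Equiv.sumCongr (Equiv.sumCongr (1 : Equiv.Perm (Fin n)) (Equiv.refl S))
      (Equiv.refl (Fin v × Fin 3))) = Equiv.refl _ := by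
    ext x
    rcases x with (x | x) | x <;> rfl
  rw [signedPerm, koszulSign_one, one_smul]
  unfold WeilDiagram.permuteLegs
  simp only [h]
  rfl

theorem update_comp_symm {n : ℕ} (g : Fin n → LegGrade) (σ : Equiv.Perm (Fin n)) (i : Fin n)
    (x : LegGrade) :
    Function.update g i x ∘ σ.symm = Function.update (g ∘ σ.symm) (σ i) x := by
  rw [Function.update_comp_equiv]
  simp

/-- The differential is a derivation of degree 1. -/
theorem ncD_signedPerm {S : Type} {n v : ℕ} (g : Fin n → LegGrade)
    (P : Pairing (HalfEdge S n v)) (σ : Equiv.Perm (Fin n)) :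
    ncD S (signedPerm g P σ) = ∑ i, if g i = LegGrade.one then
      legSign g i • signedPerm (Function.update g i LegGrade.two) P σ else 0 := by
  rw [signedPerm, map_smul, ncD_ncMk, dGen, Finset.smul_sum]
  change ∑ i : Fin n, koszulSign g σ • (if (g ∘ σ.symm) i = LegGrade.one then
    legSign (g ∘ σ.symm) i • _ else 0) = _
  rw [← Equiv.sum_comp σ]
  refine Finset.sum_congr rfl fun i _ => ?_
  have hi : (g ∘ σ.symm) (σ i) = g i := by simp
  rw [hi]
  split_ifs with h
  · have hD : (WeilDiagram.permuteLegs ⟨n, g, v, P⟩ σ).raiseLeg (σ i)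
        = WeilDiagram.permuteLegs ⟨n, Function.update g i LegGrade.two, v, P⟩ σ := by
      simp only [WeilDiagram.permuteLegs, WeilDiagram.raiseLeg]
      congr 1
      exact (update_comp_symm g σ i _).symm
    rw [hD, signedPerm, legSign_perm, smul_smul, smul_smul, koszulSign_update, h]
    congr 1
    have h2 := crossSign_mul_self g σ i
    simp only [LegGrade.val]
    linear_combination (-legSign g i * crossSign g σ i * koszulSign g σ) * h2
  · simp

theorem specialEquiv_permute {n v : ℕ} (P : Pairing (HalfEdge Empty (n + 1) v))
    (g : Fin (n + 1) → LegGrade) (σ : Equiv.Perm (Fin (n + 1))) (i : Fin (n + 1)) :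
    legToSpecial (g ∘ σ.symm) v (P.map (Equiv.sumCongr (Equiv.sumCongr σ (Equiv.refl Empty))
      (Equiv.refl (Fin v × Fin 3)))) (σ i)
      = WeilDiagram.permuteLegs ⟨n, g ∘ i.succAbove, v, P.map (specialEquiv v i)⟩
        (delPerm σ i) := by
  simp only [legToSpecial, WeilDiagram.permuteLegs, Pairing.map_map]
  congr 1
  · ext q
    have := succAbove_delPerm σ i ((delPerm σ i).symm q)
    rw [Equiv.apply_symm_apply] at this
    simp [this]
  · congr 1
    ext x
    rcases x with (x | x) | x
    · rcases Fin.eq_self_or_eq_succAbove i x with rfl | ⟨q, rfl⟩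
      · simp [specialEquiv]
      · simp [specialEquiv, ← succAbove_delPerm]
    · exact x.elim
    · simp [specialEquiv]

/-- The edges of the diagram that results when a fork is glued to the leg `i`. -/
def forkPairing {n v : ℕ} (P : Pairing (HalfEdge Empty n v)) (i : Fin n) :
    Pairing (HalfEdge Unit n (v + 1)) :=
  (P.sum (Pairing.edge.sum Pairing.edge)).map (forkEquiv v i)

theorem legToFork_permute {n v : ℕ} (P : Pairing (HalfEdge Empty n v))
    (g : Fin n → LegGrade) (σ : Equiv.Perm (Fin n)) (i : Fin n) :
    legToFork (g ∘ σ.symm) v (P.map (Equiv.sumCongr (Equiv.sumCongr σ (Equiv.refl Empty))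
      (Equiv.refl (Fin v × Fin 3)))) (σ i)
      = WeilDiagram.permuteLegs ⟨n, Function.update g i LegGrade.one, v + 1, forkPairing P i⟩
        σ := by
  have key : ∀ e : HalfEdge Empty n v ≃ HalfEdge Empty n v,
      (P.map e).sum (Pairing.edge.sum Pairing.edge)
      = (P.sum (Pairing.edge.sum Pairing.edge)).map (Equiv.sumCongr e (Equiv.refl _)) := by
    intro e
    ext x
    rcases x with x | x <;> simp [Pairing.map, Pairing.sum]
  simp only [legToFork, WeilDiagram.permuteLegs, forkPairing, key, Pairing.map_map]
  congr 1
  · exact (update_comp_symm g σ i _).symm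
  · congr 1
    ext x
    rcases x with ((x | x) | x) | ((_ | _) | (_ | _))
    · by_cases h : x = i
      · subst h; simp [forkEquiv]
      · simp [forkEquiv, h]
    · exact x.elim
    · simp [forkEquiv]
    · simp [forkEquiv]
    · simp [forkEquiv]
    · simp [forkEquiv]
    · simp [forkEquiv]

/-- The map `ι` is a derivation of degree -1. -/
theorem ncIota_signedPerm {n v : ℕ} (g : Fin (n + 1) → LegGrade)
    (P : Pairing (HalfEdge Empty (n + 1) v)) (σ : Equiv.Perm (Fin (n + 1))) :
    ncIota (signedPerm g P σ) = ∑ i, legSign g i • (if g i = LegGrade.one then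
        signedPerm (g ∘ i.succAbove) (P.map (specialEquiv v i)) (delPerm σ i)
      else signedPerm (Function.update g i LegGrade.one) (forkPairing P i) σ) := by
  rw [signedPerm, map_smul, ncIota_ncMk]
  simp only [WeilDiagram.permuteLegs, iotaGen]
  rw [Finset.smul_sum, ← Equiv.sum_comp σ]
  refine Finset.sum_congr rfl fun i _ => ?_
  have hi : (g ∘ σ.symm) (σ i) = g i := by simp
  have h2 := crossSign_mul_self g σ i
  rw [hi, legSign_perm, specialEquiv_permute, legToFork_permute, signedPerm, signedPerm,
    koszulSign_update, koszulSign_delPerm g σ i]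
  cases h : g i with
  | one =>
    simp only [LegGrade.val, if_true, smul_smul]
    congr 1
    linear_combination (legSign g i * koszulSign (g ∘ i.succAbove) (delPerm σ i)) * h2
  | two =>
    simp only [LegGrade.val, reduceCtorEq, if_false, smul_smul]
    congr 1
    linear_combination (-legSign g i * koszulSign (g ∘ i.succAbove) (delPerm σ i)
      * crossSign g σ i ^ 3) * h2

theorem ncIota_signedPerm_zero {v : ℕ} (g : Fin 0 → LegGrade)
    (P : Pairing (HalfEdge Empty 0 v)) (σ : Equiv.Perm (Fin 0)) :
    ncIota (signedPerm g P σ) = 0 := by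
  rw [signedPerm, map_smul, ncIota_ncMk]
  exact smul_zero _

/-! ### Attaching the special vertex to half-edges -/

theorem eq_zero_of_eq_neg {M : Type*} [AddCommGroup M] [Module ℚ M] {x : M} (h : x = -x) :
    x = 0 := by
  have h2 : (2 : ℚ) • x = 0 := by
    rw [two_smul]
    nth_rewrite 1 [h]
    exact neg_add_cancel x
  exact (smul_eq_zero.1 h2).resolve_left two_ne_zero

/-- The class of the diagram with leg grades `g` and edges `P`, after the slots of its trivalent
vertices have been permuted by `π`. -/
def moveMk {S : Type} {n v : ℕ} (g : Fin n → LegGrade) (P : Pairing (HalfEdge S n v))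
    (π : Equiv.Perm (Fin v × Fin 3)) : NCWeil S :=
  ncMk ⟨n, g, v, P.map (innerEquiv S n π)⟩

section

variable {S : Type} {n v : ℕ} (g : Fin n → LegGrade) (P : Pairing (HalfEdge S n v))
  (π : Equiv.Perm (Fin v × Fin 3))

theorem moveMk_one : moveMk g P 1 = ncMk ⟨n, g, v, P⟩ := by
  have : innerEquiv S n (1 : Equiv.Perm (Fin v × Fin 3)) = Equiv.refl _ := by
    ext x : 1
    rcases x with x | x <;> rfl
  rw [moveMk, this]
  rfl

theorem moveMk_mul (π' : Equiv.Perm (Fin v × Fin 3)) :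
    moveMk g P (π' * π) = ncMk (WeilDiagram.move ⟨n, g, v, P.map (innerEquiv S n π)⟩ π') := by
  unfold moveMk WeilDiagram.move
  rw [Pairing.map_map]
  congr 3
  ext x : 1
  rcases x with x | x <;> simp [innerEquiv]

theorem moveMk_iso (ρ : Equiv.Perm (Fin v)) (r : Fin v → Fin 3) :
    moveMk g P (isoPerm ρ r * π) = moveMk g P π := by
  rw [moveMk_mul]
  exact (sub_eq_zero.1 (ncMk_iso ⟨n, g, v, P.map (innerEquiv S n π)⟩ ρ r)).symm

theorem moveMk_as (u : Fin v) : moveMk g P (asPerm u * π) = -moveMk g P π := by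
  rw [moveMk_mul]
  exact (neg_eq_of_add_eq_zero_right (ncMk_as ⟨n, g, v, P.map (innerEquiv S n π)⟩ u)).symm

/-- Any transposition of two slots reverses the orientation: this one is `asPerm` followed by a
rotation. -/
theorem moveMk_swap_two (u : Fin v) :
    moveMk g P (Equiv.swap (u, 0) (u, 2) * π) = -moveMk g P π := by
  have h : Equiv.swap (u, 0) (u, 2)
      = isoPerm (Equiv.refl _) (fun x : Fin v => if x = u then 1 else 0) * asPerm u := by
    ext x : 1
    obtain ⟨x, c⟩ := x
    by_cases hx : x = u
    · subst hx
      fin_cases c <;> simp [isoPerm, asPerm, Equiv.swap_apply_def]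
    · simp [isoPerm, asPerm, Equiv.swap_apply_def, hx]
  rw [h, mul_assoc, moveMk_iso, moveMk_as]

theorem moveMk_ihx (u w : Fin v) (huw : u ≠ w)
    (h : P.other (Sum.inr (π.symm (u, 2))) = Sum.inr (π.symm (w, 0))) :
    moveMk g P π + moveMk g P (ihxPerm u w * π) + moveMk g P ((ihxPerm u w)⁻¹ * π) = 0 := by
  rw [moveMk_mul, moveMk_mul]
  refine ncMk_ihx ⟨n, g, v, P.map (innerEquiv S n π)⟩ u w huw ?_
  simp [Pairing.map, innerEquiv, h]

end

theorem innerEquiv_swap {S : Type} [DecidableEq S] {n v : ℕ} (a b : Fin v × Fin 3) :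
    innerEquiv S n (Equiv.swap a b) = Equiv.swap (Sum.inr a) (Sum.inr b) := by
  ext x : 1
  rcases x with x | x
  · simp [innerEquiv, Equiv.swap_apply_def]
  · simp only [innerEquiv, Equiv.sumCongr_apply, Sum.map_inr, Equiv.swap_apply_def,
      Sum.inr.injEq]
    split_ifs <;> rfl

/-- The half-edges of a diagram and two new edges, as the half-edges of a diagram with one more
trivalent vertex. The first new edge joins the special vertex to the slot 1 of the new vertex, the
second one its slots 0 and 2. -/
def attachBase (n v : ℕ) :
    HalfEdge Empty n v ⊕ (Bool ⊕ Bool) ≃ HalfEdge Unit n (v + 1) where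
  toFun
    | Sum.inl (Sum.inl (Sum.inl j)) => Sum.inl (Sum.inl j)
    | Sum.inl (Sum.inr (u, c)) => Sum.inr (u.castSucc, c)
    | Sum.inr (Sum.inl false) => Sum.inl (Sum.inr ())
    | Sum.inr (Sum.inl true) => Sum.inr (Fin.last v, 1)
    | Sum.inr (Sum.inr false) => Sum.inr (Fin.last v, 0)
    | Sum.inr (Sum.inr true) => Sum.inr (Fin.last v, 2)
  invFun
    | Sum.inl (Sum.inl j) => Sum.inl (Sum.inl (Sum.inl j))
    | Sum.inl (Sum.inr _) => Sum.inr (Sum.inl false)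
    | Sum.inr (u, c) =>
        Fin.lastCases (motive := fun _ => HalfEdge Empty n v ⊕ (Bool ⊕ Bool))
          (match c with
            | 0 => Sum.inr (Sum.inr false)
            | 1 => Sum.inr (Sum.inl true)
            | 2 => Sum.inr (Sum.inr true))
          (fun u' => Sum.inl (Sum.inr (u', c))) u
  left_inv := by
    rintro (((j | j) | ⟨u, c⟩) | ((_ | _) | (_ | _)))
    · simp
    · exact j.elim
    all_goals simp
  right_inv := by
    rintro ((j | j) | ⟨u, c⟩)
    · simp
    · simp
    · induction u using Fin.lastCases with
      | last => fin_cases c <;> simp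
      | cast u => simp

/-- The edges of the diagram in which the special vertex is attached to the edge that contains the
half-edge `h`: the slot 0 of the new trivalent vertex takes the place of `h`, its slot 1 is
joined to the special vertex, and its slot 2 is joined to `h`. -/
def attach {n v : ℕ} (P : Pairing (HalfEdge Empty n v)) (h : HalfEdge Empty n v) :
    Pairing (HalfEdge Unit n (v + 1)) :=
  ((P.sum (Pairing.edge.sum Pairing.edge)).map (attachBase n v)).map
    (Equiv.swap (attachBase n v (Sum.inl h)) (Sum.inr (Fin.last v, 0)))

theorem forkPairing_eq_attach {n v : ℕ} (P : Pairing (HalfEdge Empty n v)) (i : Fin n) :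
    forkPairing P i = attach P (Sum.inl (Sum.inl i)) := by
  unfold forkPairing attach
  rw [Pairing.map_map]
  congr 1
  ext x : 1
  rcases x with ((x | x) | x) | ((_ | _) | (_ | _))
  · by_cases h : x = i
    · subst h; simp [forkEquiv, attachBase]
    · simp [forkEquiv, attachBase, h, Equiv.swap_apply_def]
  · exact x.elim
  · simp [forkEquiv, attachBase, Equiv.swap_apply_def]
  · simp [forkEquiv, attachBase, Equiv.swap_apply_def]
  · simp [forkEquiv, attachBase, Equiv.swap_apply_def]
  · simp [forkEquiv, attachBase]
  · simp [forkEquiv, attachBase, Equiv.swap_apply_def]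

/-- The class of the diagram with the special vertex attached at the half-edge `h`. -/
def attachMk {n v : ℕ} (g : Fin n → LegGrade) (P : Pairing (HalfEdge Empty n v))
    (h : HalfEdge Empty n v) : NCWeil Unit :=
  ncMk ⟨n, g, v + 1, attach P h⟩

theorem Pairing.map_eq_map {H H' : Type} (P : Pairing H) (e f : H ≃ H')
    (h : ∀ x, f.symm (e (P.other x)) = P.other (f.symm (e x))) : P.map e = P.map f := by
  ext y
  have := h (e.symm y)
  rw [Equiv.apply_symm_apply, Equiv.symm_apply_eq] at this
  exact this

/-- An edge with halves `a`, `b` and an edge with halves `c`, `d` can be exchanged. -/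
theorem Pairing.map_exchange {H : Type} [DecidableEq H] (P : Pairing H) {a b c d : H}
    (hab : P.other a = b) (hcd : P.other c = d) (hac : a ≠ c) (had : a ≠ d) :
    P.map (Equiv.swap b c) = P.map ((Equiv.swap a c).trans (Equiv.swap c d)) := by
  have hba : P.other b = a := by rw [← hab, P.other_other]
  have hdc : P.other d = c := by rw [← hcd, P.other_other]
  have hab' : b ≠ a := hab ▸ P.other_ne a
  have hcd' : d ≠ c := hcd ▸ P.other_ne c
  have hbc : b ≠ c := fun h => had (by rw [← hba, h, hcd])
  have hbd : b ≠ d := fun h => hac (by rw [← hba, h, hdc])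
  refine P.map_eq_map _ _ fun x => ?_
  by_cases hxa : x = a
  · subst hxa
    simp [Equiv.swap_apply_def, *, Ne.symm]
  by_cases hxb : x = b
  · subst hxb
    simp [Equiv.swap_apply_def, *, Ne.symm]
  by_cases hxc : x = c
  · subst hxc
    simp [Equiv.swap_apply_def, *, Ne.symm]
  by_cases hxd : x = d
  · subst hxd
    simp [Equiv.swap_apply_def, *, Ne.symm]
  have h1 : P.other x ≠ a := fun h => hxb (by rw [← hab, ← h, P.other_other])
  have h2 : P.other x ≠ b := fun h => hxa (by rw [← hba, ← h, P.other_other])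
  have h3 : P.other x ≠ c := fun h => hxd (by rw [← hcd, ← h, P.other_other])
  have h4 : P.other x ≠ d := fun h => hxc (by rw [← hdc, ← h, P.other_other])
  simp [Equiv.swap_apply_def, *]

theorem Pairing.map_swap_other {H : Type} [DecidableEq H] (P : Pairing H) (x : H) :
    P.map (Equiv.swap x (P.other x)) = P := by
  ext y
  simp only [Pairing.map, Equiv.symm_swap]
  by_cases h1 : y = x
  · subst h1; simp [P.other_other]
  · by_cases h2 : y = P.other x
    · subst h2; simp [P.other_other]
    · rw [Equiv.swap_apply_of_ne_of_ne h1 h2, Equiv.swap_apply_of_ne_of_ne]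
      · exact fun h => h2 (by rw [← h, P.other_other])
      · exact fun h => h1 (by rw [← P.other_other y, h, P.other_other])

/-- By antisymmetry, the special vertex can be moved to the other half of an edge at the cost of a
sign. -/
theorem attachMk_other {n v : ℕ} (g : Fin n → LegGrade) (P : Pairing (HalfEdge Empty n v))
    (h : HalfEdge Empty n v) : attachMk g P h + attachMk g P (P.other h) = 0 := by
  have key : attach P (P.other h)
      = (attach P h).map (innerEquiv Unit n (Equiv.swap (Fin.last v, 0) (Fin.last v, 2))) := by
    rw [innerEquiv_swap]
    unfold attach
    -- Before the new vertex takes the place of a half-edge, the edge of `h` and the edge that joins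
    -- the slots 0 and 2 of the new vertex can be exchanged.
    refine (Pairing.map_exchange (H := HalfEdge Unit n (v + 1)) _ ?_ ?_ ?_ ?_).trans
      (Pairing.map_map _ _ _).symm
    · simp [Pairing.map, Pairing.sum]
    · simp [Pairing.map, Pairing.sum, Pairing.edge, attachBase]
    · exact fun h' => Sum.inl_ne_inr ((attachBase n v).injective
        (h'.trans (show _ = attachBase n v (Sum.inr (Sum.inr false)) from rfl)))
    · exact fun h' => Sum.inl_ne_inr ((attachBase n v).injective
        (h'.trans (show _ = attachBase n v (Sum.inr (Sum.inr true)) from rfl)))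
  rw [attachMk, attachMk, key]
  have h2 := moveMk_swap_two g (attach P h) 1 (Fin.last v)
  rw [mul_one, moveMk_one, moveMk] at h2
  rw [h2, add_neg_cancel]

/-- When two of the slots of the vertex `u` are joined to each other, a half-edge at `w` can be
cut and the ends connected to the slots 0 and 2 of `u`; the sum over the three half-edges at `w`
vanishes by the IHX relation. -/
theorem moveMk_vertex {S : Type} [DecidableEq S] {n v : ℕ} (g : Fin n → LegGrade)
    (P : Pairing (HalfEdge S n v)) (u w : Fin v) (huw : u ≠ w)
    (h : P.other (Sum.inr (u, 0)) = Sum.inr (u, 2)) :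
    moveMk g P (Equiv.swap (w, 0) (u, 0)) + moveMk g P (Equiv.swap (w, 1) (u, 0))
      + moveMk g P (Equiv.swap (w, 2) (u, 0)) = 0 := by
  have h2 : P.other (Sum.inr (u, 2)) = Sum.inr (u, 0) := by rw [← h, P.other_other]
  have hihx := moveMk_ihx g P (Equiv.swap (w, 0) (u, 0)) u w huw (by
    simp [h2, Equiv.swap_apply_def, huw])
  -- The half-edge `(w, 1)`: antisymmetry at `u` and at `w`, where the two signs cancel.
  have e1 : moveMk g P (Equiv.swap (w, 1) (u, 0))
      = moveMk g P ((ihxPerm u w)⁻¹ * Equiv.swap (w, 0) (u, 0)) := by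
    rw [← neg_neg (moveMk g P ((ihxPerm u w)⁻¹ * _)), ← moveMk_as g P _ u, ← moveMk_as g P _ w]
    congr 1
    ext x : 1
    obtain ⟨x, c⟩ := x
    by_cases hx : x = u
    · subst hx
      fin_cases c <;> simp [ihxPerm, asPerm, Equiv.swap_apply_def, huw, huw.symm]
    · by_cases hx' : x = w
      · subst hx'
        fin_cases c <;> simp [ihxPerm, asPerm, Equiv.swap_apply_def, huw, huw.symm]
      · simp [ihxPerm, asPerm, Equiv.swap_apply_def, hx, hx']
  -- The edge that joins the slots 0 and 2 of `u` may be reversed.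
  have e3 : moveMk g P (Equiv.swap (w, 2) (u, 0))
      = moveMk g P (Equiv.swap (w, 2) (u, 0) * Equiv.swap (u, 0) (u, 2)) := by
    have hs : P.map (innerEquiv S n (Equiv.swap (u, 0) (u, 2))) = P := by
      rw [innerEquiv_swap, ← h, Pairing.map_swap_other]
    rw [moveMk_mul, hs]
    rfl
  -- The half-edge `(w, 2)`: the vertices `u` and `w` are exchanged, and then antisymmetry is used at
  -- both of them.
  have e2 : moveMk g P (Equiv.swap (w, 2) (u, 0) * Equiv.swap (u, 0) (u, 2))
      = moveMk g P (ihxPerm u w * Equiv.swap (w, 0) (u, 0)) := by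
    rw [← moveMk_iso g P (ihxPerm u w * _) (Equiv.swap u w) 0,
      ← neg_neg (moveMk g P (isoPerm _ _ * _)), ← moveMk_as g P _ w, ← moveMk_swap_two g P _ u]
    congr 1
    ext x : 1
    obtain ⟨x, c⟩ := x
    by_cases hx : x = u
    · subst hx
      fin_cases c <;> simp [ihxPerm, asPerm, isoPerm, Equiv.swap_apply_def, huw, huw.symm]
    · by_cases hx' : x = w
      · subst hx'
        fin_cases c <;> simp [ihxPerm, asPerm, isoPerm, Equiv.swap_apply_def, huw, huw.symm]
      · simp [ihxPerm, asPerm, isoPerm, Equiv.swap_apply_def, hx, hx']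
  rw [e1, e3, e2, ← hihx]
  abel

/-- By the IHX relation, the special vertex attached to the three half-edges at a trivalent vertex
gives zero. -/
theorem attachMk_vertex {n v : ℕ} (g : Fin n → LegGrade) (P : Pairing (HalfEdge Empty n v))
    (u : Fin v) : attachMk g P (Sum.inr (u, 0)) + attachMk g P (Sum.inr (u, 1))
      + attachMk g P (Sum.inr (u, 2)) = 0 := by
  have key : ∀ c, attachMk g P (Sum.inr (u, c))
      = moveMk g ((P.sum (Pairing.edge.sum Pairing.edge)).map (attachBase n v))
        (Equiv.swap (u.castSucc, c) (Fin.last v, 0)) := by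
    intro c
    rw [moveMk, innerEquiv_swap]
    rfl
  simp only [key]
  refine moveMk_vertex _ _ _ _ (Fin.castSucc_lt_last u).ne' ?_
  simp [Pairing.map, Pairing.sum, Pairing.edge, attachBase]

/-- The diagrams that result when the special vertex is attached to each of the legs in turn add up
to zero. -/
theorem sum_attachMk_legs {n v : ℕ} (g : Fin n → LegGrade) (P : Pairing (HalfEdge Empty n v)) :
    ∑ i, ncMk ⟨n, g, v + 1, forkPairing P i⟩ = 0 := by
  have h1 : ∑ h, attachMk g P h = 0 := by
    let e : Equiv.Perm (HalfEdge Empty n v) := ⟨P.other, P.other, P.other_other, P.other_other⟩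
    have h : ∑ h, attachMk g P h = -∑ h, attachMk g P h := by
      conv_lhs => rw [← Equiv.sum_comp e]
      rw [← Finset.sum_neg_distrib]
      exact Finset.sum_congr rfl fun x _ => (neg_eq_of_add_eq_zero_right (attachMk_other g P x)).symm
    exact eq_zero_of_eq_neg h
  rw [Fintype.sum_sum_type, Fintype.sum_sum_type, Fintype.sum_prod_type] at h1
  simp only [Fin.sum_univ_three, attachMk_vertex, Finset.sum_const_zero, add_zero,
    Finset.univ_eq_empty, Finset.sum_empty] at h1
  simpa only [attachMk, ← forkPairing_eq_attach] using h1

/-! ### Grading -/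

theorem ncMk_mem {S : Type} (D : WeilDiagram S) : ncMk D ∈ ncGr S D.legGrade :=
  Submodule.subset_span ⟨D, rfl, rfl⟩

theorem mem_ncGr_of_ncMk {S S' : Type} (f : NCWeil S →ₗ[ℚ] NCWeil S') (k : ℤ)
    (h : ∀ D, f (ncMk D) ∈ ncGr S' (D.legGrade + k)) (i : ℤ) (x : NCWeil S) (hx : x ∈ ncGr S i) :
    f x ∈ ncGr S' (i + k) := by
  have : ncGr S i ≤ (ncGr S' (i + k)).comap f := by
    refine Submodule.span_le.2 ?_
    rintro _ ⟨D, rfl, rfl⟩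
    exact h D
  exact this hx

/-- The projection to the part of leg-grade `i`, on diagrams. -/
def projGen {S : Type} (i : ℤ) (D : WeilDiagram S) : NCWeil S :=
  if (D.legGrade : ℤ) = i then ncMk D else 0

theorem projGen_rel {S : Type} (i : ℤ) (x : Formal S) (hx : DiagramRel S x) :
    ext (projGen i) x = 0 := by
  have h : ∀ (D : WeilDiagram S) π, projGen i (D.move π)
      = if (D.legGrade : ℤ) = i then ncMk (D.move π) else 0 := fun _ _ => rfl
  cases hx with
  | iso D ρ r =>
    rw [map_sub, ext_gen, ext_gen, h, projGen]
    split_ifs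
    · exact ncMk_iso D ρ r
    · exact sub_zero 0
  | as D u =>
    rw [map_add, ext_gen, ext_gen, h, projGen]
    split_ifs
    · exact ncMk_as D u
    · exact add_zero 0
  | ihx D u w huw hedge =>
    rw [map_add, map_add, ext_gen, ext_gen, ext_gen, h, h, projGen]
    split_ifs
    · exact ncMk_ihx D u w huw hedge
    · simp

/-- The projection to the part of leg-grade `i`. -/
def ncProj (S : Type) (i : ℤ) : NCWeil S →ₗ[ℚ] NCWeil S :=
  (ncRelations S).liftQ (ext (projGen i)) (Submodule.span_le.2 (projGen_rel i))

theorem ncProj_ncMk {S : Type} (i : ℤ) (D : WeilDiagram S) :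
    ncProj S i (ncMk D) = if (D.legGrade : ℤ) = i then ncMk D else 0 :=
  ext_gen (projGen i) D

/-- The relations are homogeneous, and hence the projections separate the graded parts. -/
theorem ncGr_isInternal (S : Type) : DirectSum.IsInternal (ncGr S) := by
  refine DirectSum.isInternal_submodule_of_iSupIndep_of_iSup_eq_top ?_ ?_
  · intro i
    rw [Submodule.disjoint_def]
    intro x hx hx'
    have h1 : ncProj S i x = x := by
      have : ncGr S i ≤ LinearMap.eqLocus (ncProj S i) LinearMap.id := by
        refine Submodule.span_le.2 ?_
        rintro _ ⟨D, hD, rfl⟩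
        exact (ncProj_ncMk i D).trans (if_pos hD)
      exact this hx
    have h2 : ncProj S i x = 0 := by
      have : ⨆ j, ⨆ (_ : j ≠ i), ncGr S j ≤ LinearMap.ker (ncProj S i) := by
        refine iSup₂_le fun j hj => Submodule.span_le.2 ?_
        rintro _ ⟨D, rfl, rfl⟩
        exact (ncProj_ncMk i D).trans (if_neg hj)
      exact this hx'
    rw [← h1, h2]
  · rw [eq_top_iff]
    intro x _
    obtain ⟨y, rfl⟩ := (ncRelations S).mkQ_surjective x
    induction y using Finsupp.induction_linear with
    | zero => exact (map_zero (ncRelations S).mkQ).symm ▸ Submodule.zero_mem _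
    | add y z hy hz => exact (map_add (ncRelations S).mkQ y z).symm ▸
        Submodule.add_mem _ (hy trivial) (hz trivial)
    | single D a =>
      have : (ncRelations S).mkQ (Finsupp.single D a) = a • ncMk D := by
        rw [ncMk, gen, ← map_smul, Finsupp.smul_single, smul_eq_mul, mul_one]
      rw [this]
      exact Submodule.smul_mem _ _ (Submodule.mem_iSup_of_mem _ (ncMk_mem D))

theorem ncGr_neg {S : Type} (i : ℤ) (hi : i < 0) : ncGr S i = ⊥ := by
  refine eq_bot_iff.2 (Submodule.span_le.2 ?_)
  rintro _ ⟨D, hD, rfl⟩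
  omega

/-- Rearranging the legs does not change the leg-grade. -/
theorem signedPerm_mem {S : Type} {n v : ℕ} (g : Fin n → LegGrade)
    (P : Pairing (HalfEdge S n v)) (σ : Equiv.Perm (Fin n)) (i : ℤ)
    (hi : ((∑ j, (g j).val : ℕ) : ℤ) = i) : signedPerm g P σ ∈ ncGr S i := by
  refine Submodule.smul_mem _ _ (Submodule.subset_span ⟨_, ?_, rfl⟩)
  rw [← hi]
  exact congrArg Nat.cast (Equiv.sum_comp σ.symm fun j => (g j).val)

theorem sum_update_val {n : ℕ} (g : Fin n → LegGrade) (j : Fin n) (x : LegGrade) :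
    ∑ i, (Function.update g j x i).val + (g j).val = ∑ i, (g i).val + x.val := by
  rw [← Finset.add_sum_erase _ _ (Finset.mem_univ j),
    ← Finset.add_sum_erase (a := j) _ (fun i => (g i).val) (Finset.mem_univ j),
    Function.update_self, Finset.sum_congr rfl (g := fun i => (g i).val) fun i hi => by
      rw [Function.update_of_ne (Finset.ne_of_mem_erase hi)]]
  omega

/-! ### Operators that change the grade of one leg -/

/-- The other grade. -/
def LegGrade.flip : LegGrade → LegGrade
  | one => two
  | two => one

/-- A combination, with coefficients `c j σ`, of signed rearrangements of the legs. -/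
def permSum {S : Type} (c : ∀ n, Fin n → Equiv.Perm (Fin n) → ℚ) {n v : ℕ} (j : Fin n)
    (g : Fin n → LegGrade) (P : Pairing (HalfEdge S n v)) : NCWeil S :=
  ∑ σ, c n j σ • signedPerm g P σ

/-- The operator, on diagrams, that changes the grade `x` of one leg `j` into the other grade, with
the sign of an operator of odd degree, and that rearranges the legs in the way given by `c j`. -/
def legOpGen {S : Type} (c : ∀ n, Fin n → Equiv.Perm (Fin n) → ℚ) (x : LegGrade)
    (D : WeilDiagram S) : NCWeil S :=
  ∑ j, if D.grade j = x then
    legSign D.grade j • permSum c j (Function.update D.grade j x.flip) D.edges else 0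

section

variable {S : Type} (c : ∀ n, Fin n → Equiv.Perm (Fin n) → ℚ) {n v : ℕ} (j : Fin n)
  (g : Fin n → LegGrade) (P : Pairing (HalfEdge S n v))

theorem signedPerm_move (π : Equiv.Perm (Fin v × Fin 3)) (σ : Equiv.Perm (Fin n)) :
    signedPerm g (P.map (innerEquiv S n π)) σ = koszulSign g σ • moveMk (g ∘ σ.symm)
      (P.map (Equiv.sumCongr (Equiv.sumCongr σ (Equiv.refl S)) (Equiv.refl _))) π :=
  congrArg (fun E => koszulSign g σ • ncMk E) (permuteLegs_move ⟨n, g, v, P⟩ π σ)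

theorem signedPerm_eq_moveMk (σ : Equiv.Perm (Fin n)) :
    signedPerm g P σ = koszulSign g σ • moveMk (g ∘ σ.symm)
      (P.map (Equiv.sumCongr (Equiv.sumCongr σ (Equiv.refl S)) (Equiv.refl _))) 1 := by
  rw [moveMk_one]
  rfl

theorem permSum_iso (ρ : Equiv.Perm (Fin v)) (r : Fin v → Fin 3) :
    permSum c j g (P.map (innerEquiv S n (isoPerm ρ r))) = permSum c j g P := by
  refine Finset.sum_congr rfl fun σ _ => ?_
  rw [signedPerm_move, signedPerm_eq_moveMk, ← mul_one (isoPerm ρ r), moveMk_iso]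

theorem permSum_as (u : Fin v) :
    permSum c j g (P.map (innerEquiv S n (asPerm u))) = -permSum c j g P := by
  rw [permSum, permSum, ← Finset.sum_neg_distrib]
  refine Finset.sum_congr rfl fun σ _ => ?_
  rw [signedPerm_move, signedPerm_eq_moveMk, ← mul_one (asPerm u), moveMk_as, smul_neg, smul_neg]

theorem permSum_ihx (u w : Fin v) (huw : u ≠ w)
    (hedge : P.other (Sum.inr (u, 2)) = Sum.inr (w, 0)) :
    permSum c j g P + permSum c j g (P.map (innerEquiv S n (ihxPerm u w)))
      + permSum c j g (P.map (innerEquiv S n (ihxPerm u w)⁻¹)) = 0 := by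
  rw [permSum, permSum, permSum, ← Finset.sum_add_distrib, ← Finset.sum_add_distrib]
  refine Finset.sum_eq_zero fun σ _ => ?_
  have h := moveMk_ihx (g ∘ σ.symm)
    (P.map (Equiv.sumCongr (Equiv.sumCongr σ (Equiv.refl S)) (Equiv.refl _))) 1 u w huw
    (by
      rw [show (1 : Equiv.Perm (Fin v × Fin 3)).symm = 1 from rfl]
      simp [Pairing.map, hedge])
  rw [mul_one, mul_one] at h
  rw [signedPerm_move, signedPerm_move, signedPerm_eq_moveMk, ← smul_add, ← smul_add, ← smul_add,
    ← smul_add, h, smul_zero, smul_zero]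

end

theorem legOpGen_rel {S : Type} (c : ∀ n, Fin n → Equiv.Perm (Fin n) → ℚ) (x : LegGrade)
    (y : Formal S) (hy : DiagramRel S y) : ext (legOpGen c x) y = 0 := by
  have hm : ∀ (D : WeilDiagram S) π, legOpGen c x (D.move π) = ∑ j, if D.grade j = x then
      legSign D.grade j • permSum c j (Function.update D.grade j x.flip)
        (D.edges.map (innerEquiv S D.n π)) else 0 := fun _ _ => rfl
  cases hy with
  | iso D ρ r =>
    rw [map_sub, ext_gen, ext_gen, hm, sub_eq_zero]
    simp only [permSum_iso]
    rfl
  | as D u =>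
    rw [map_add, ext_gen, ext_gen, hm, legOpGen, ← Finset.sum_add_distrib]
    refine Finset.sum_eq_zero fun j _ => ?_
    rw [permSum_as]
    split_ifs <;> simp
  | ihx D u w huw hedge =>
    rw [map_add, map_add, ext_gen, ext_gen, ext_gen, hm, hm, legOpGen, ← Finset.sum_add_distrib,
      ← Finset.sum_add_distrib]
    refine Finset.sum_eq_zero fun j _ => ?_
    split_ifs
    · rw [← smul_add, ← smul_add, permSum_ihx _ _ _ _ u w huw hedge, smul_zero]
    · simp

/-- The operator that changes the grade `x` of one leg `j` into the other grade and that rearranges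
the legs in the way given by `c j`. -/
def legOp (S : Type) (c : ∀ n, Fin n → Equiv.Perm (Fin n) → ℚ) (x : LegGrade) :
    NCWeil S →ₗ[ℚ] NCWeil S :=
  (ncRelations S).liftQ (ext (legOpGen c x)) (Submodule.span_le.2 (legOpGen_rel c x))

theorem legOp_ncMk {S : Type} (c : ∀ n, Fin n → Equiv.Perm (Fin n) → ℚ) (x : LegGrade)
    {n v : ℕ} (g : Fin n → LegGrade) (P : Pairing (HalfEdge S n v)) :
    legOp S c x (ncMk ⟨n, g, v, P⟩) = ∑ j, if g j = x then
      legSign g j • permSum c j (Function.update g j x.flip) P else 0 :=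
  ext_gen (legOpGen c x) ⟨n, g, v, P⟩

theorem legOp_mem {S : Type} (c : ∀ n, Fin n → Equiv.Perm (Fin n) → ℚ) (x : LegGrade)
    (i : ℤ) (y : NCWeil S) (hy : y ∈ ncGr S i) :
    legOp S c x y ∈ ncGr S (i + (x.flip.val - x.val)) := by
  refine mem_ncGr_of_ncMk _ _ (fun D => ?_) i y hy
  obtain ⟨n, g, v, P⟩ := D
  rw [legOp_ncMk]
  refine Submodule.sum_mem _ fun j _ => ?_
  split_ifs with h
  · refine Submodule.smul_mem _ _ (Submodule.sum_mem _ fun σ _ =>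
      Submodule.smul_mem _ _ (signedPerm_mem _ _ _ _ ?_))
    have := sum_update_val g j x.flip
    rw [h] at this
    simp only [WeilDiagram.legGrade]
    omega
  · exact Submodule.zero_mem _

/-- The coefficients of an operator that does not rearrange the legs. -/
def trivCoeff (n : ℕ) (_ : Fin n) (σ : Equiv.Perm (Fin n)) : ℚ := if σ = 1 then 1 else 0

theorem permSum_trivCoeff {S : Type} {n v : ℕ} (j : Fin n) (g : Fin n → LegGrade)
    (P : Pairing (HalfEdge S n v)) : permSum trivCoeff j g P = ncMk ⟨n, g, v, P⟩ := by
  simp [permSum, trivCoeff, signedPerm_one]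

theorem ncD_eq_legOp (S : Type) : ncD S = legOp S trivCoeff LegGrade.one := by
  refine ncWeil_hom_ext fun D => ?_
  obtain ⟨n, g, v, P⟩ := D
  rw [legOp_ncMk, ← signedPerm_one, ncD_signedPerm]
  simp only [permSum_trivCoeff, signedPerm_one, LegGrade.flip]

theorem ncD_permSum {S : Type} (c : ∀ n, Fin n → Equiv.Perm (Fin n) → ℚ) {n v : ℕ} (j : Fin n)
    (g : Fin n → LegGrade) (P : Pairing (HalfEdge S n v)) :
    ncD S (permSum c j g P) = ∑ i, if g i = LegGrade.one then
      legSign g i • permSum c j (Function.update g i LegGrade.two) P else 0 := by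
  simp only [permSum, map_sum, map_smul, ncD_signedPerm, Finset.smul_sum]
  rw [Finset.sum_comm]
  refine Finset.sum_congr rfl fun i _ => ?_
  split_ifs
  · exact Finset.sum_congr rfl fun σ _ => smul_comm _ _ _
  · simp

theorem legSign_flip {n : ℕ} (g : Fin n → LegGrade) (i j : Fin n) :
    legSign (Function.update g i (g i).flip) j = (if i < j then -1 else 1) * legSign g j := by
  rw [legSign_update]
  cases g i <;> norm_num [LegGrade.flip, LegGrade.val]

/-- If the terms for pairs of different legs cancel, only the diagonal terms remain. -/
theorem sum_sum_add_sum_sum {n : ℕ} {M : Type*} [AddCommGroup M] (A B : Fin n → Fin n → M)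
    (h : ∀ i j, i ≠ j → A i j + B j i = 0) :
    ∑ i, ∑ j, A i j + ∑ i, ∑ j, B i j = ∑ i, (A i i + B i i) := by
  rw [Finset.sum_comm (f := B), ← Finset.sum_add_distrib]
  refine Finset.sum_congr rfl fun i _ => ?_
  rw [← Finset.sum_add_distrib]
  exact Finset.sum_eq_single i (fun j _ hj => h i j hj.symm) (by simp)

/-- The commutator of the differential with an operator that changes grades: changes of different
legs anticommute, so that only the terms survive in which the same leg is changed twice. -/
theorem ncD_legOp {S : Type} (c : ∀ n, Fin n → Equiv.Perm (Fin n) → ℚ) (x : LegGrade)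
    {n v : ℕ} (g : Fin n → LegGrade) (P : Pairing (HalfEdge S n v)) :
    ncD S (legOp S c x (ncMk ⟨n, g, v, P⟩)) + legOp S c x (ncD S (ncMk ⟨n, g, v, P⟩))
      = if x = LegGrade.two then ∑ j, permSum c j g P else 0 := by
  rw [legOp_ncMk, ← signedPerm_one, ncD_signedPerm, map_sum, map_sum]
  simp only [signedPerm_one, apply_ite (ncD S), apply_ite (legOp S c x), map_zero, map_smul,
    ncD_permSum, legOp_ncMk]
  have h : ∀ (a : ℚ) (Q : Prop) [Decidable Q] (F : Fin n → NCWeil S),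
      (if Q then a • ∑ i, F i else 0) = ∑ i, if Q then a • F i else 0 := by
    intro a Q _ F
    split_ifs
    · exact Finset.smul_sum
    · simp
  simp only [h]
  rw [sum_sum_add_sum_sum]
  · have hL : ∀ (g' : Fin n → LegGrade) (j : Fin n) (y : LegGrade),
        legSign (Function.update g' j y) j = legSign g' j := fun g' j y => by
      simp [legSign_update]
    simp only [hL, Function.update_self, Function.update_idem]
    -- A leg of grade 1 cannot be raised twice; a leg of either grade can be lowered and raised back,
    -- in exactly one of the two orders.
    cases x with
    | one => simp [LegGrade.flip]
    | two =>
      simp only [LegGrade.flip, if_true]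
      refine Finset.sum_congr rfl fun j _ => ?_
      have hu : Function.update g j (g j) = g := Function.update_eq_self j g
      cases hj : g j <;> rw [hj] at hu <;> simp [legSign_mul_self, smul_smul, hu]
  · intro j i hij
    by_cases hj : g j = x
    · by_cases hi : g i = LegGrade.one
      · subst hj
        have h1 := legSign_flip g i j
        have h2 := legSign_flip g j i
        rw [hi] at h1
        simp only [LegGrade.flip] at h1
        simp only [Function.update_of_ne hij, Function.update_of_ne hij.symm, hi, if_true, h1, h2,
          smul_smul, Function.update_comm hij, ← add_smul]
        rcases lt_or_gt_of_ne hij with h | h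
        · simp only [h, h.not_gt, if_true, if_false]
          convert zero_smul ℚ _ using 2
          ring
        · simp only [h, h.not_gt, if_true, if_false]
          convert zero_smul ℚ _ using 2
          ring
      · simp [hi, Function.update_of_ne hij.symm]
    · simp [hj, Function.update_of_ne hij]

theorem ncIota_permSum (c : ∀ n, Fin n → Equiv.Perm (Fin n) → ℚ) {n v : ℕ} (j : Fin (n + 1))
    (g : Fin (n + 1) → LegGrade) (P : Pairing (HalfEdge Empty (n + 1) v)) :
    ncIota (permSum c j g P) = ∑ i, legSign g i • (if g i = LegGrade.one then
        ∑ σ, c (n + 1) j σ •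
          signedPerm (g ∘ i.succAbove) (P.map (specialEquiv v i)) (delPerm σ i)
      else permSum c j (Function.update g i LegGrade.one) (forkPairing P i)) := by
  simp only [permSum, map_sum, map_smul, ncIota_signedPerm, Finset.smul_sum]
  rw [Finset.sum_comm]
  refine Finset.sum_congr rfl fun i _ => ?_
  split_ifs
  · rw [Finset.smul_sum]
    exact Finset.sum_congr rfl fun σ _ => smul_comm _ _ _
  · rw [Finset.smul_sum]
    exact Finset.sum_congr rfl fun σ _ => smul_comm _ _ _

theorem ncIota_ncMk_succ {n v : ℕ} (g : Fin (n + 1) → LegGrade)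
    (P : Pairing (HalfEdge Empty (n + 1) v)) :
    ncIota (ncMk ⟨n + 1, g, v, P⟩) = ∑ i, legSign g i • (if g i = LegGrade.one then
        ncMk ⟨n, g ∘ i.succAbove, v, P.map (specialEquiv v i)⟩
      else ncMk ⟨n + 1, Function.update g i LegGrade.one, v + 1, forkPairing P i⟩) := by
  rw [← signedPerm_one, ncIota_signedPerm]
  simp only [delPerm_one, signedPerm_one]

theorem update_comp_succAbove {n : ℕ} (g : Fin (n + 1) → LegGrade) (i : Fin (n + 1)) (j : Fin n)
    (x : LegGrade) : Function.update g (i.succAbove j) x ∘ i.succAbove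
      = Function.update (g ∘ i.succAbove) j x :=
  Function.update_comp_eq_of_injective _ Fin.succAbove_right_injective _ _

theorem update_self_comp_succAbove {n : ℕ} (g : Fin (n + 1) → LegGrade) (i : Fin (n + 1))
    (x : LegGrade) : Function.update g i x ∘ i.succAbove = g ∘ i.succAbove := by
  ext q
  simp [Fin.succAbove_ne]

/-- The coefficients `c` are compatible with the deletion of legs: for legs `i` and `j`, the
coefficients for `j` of the permutations that induce `ρ` after the deletion of `i` add up to the
coefficient of `ρ`. This is tested on functions with values in the target of `ι`. -/
def CompatDel (c : ∀ n, Fin n → Equiv.Perm (Fin n) → ℚ) : Prop :=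
  ∀ (n : ℕ) (i : Fin (n + 1)) (j : Fin n) (F : Equiv.Perm (Fin n) → NCWeil Unit),
    ∑ σ, c (n + 1) (i.succAbove j) σ • F (delPerm σ i) = ∑ ρ, c n j ρ • F ρ

/-- The commutator of `ι` with an operator that changes grades: operations on different legs
anticommute, so that only the terms survive in which both maps act on the same leg. -/
theorem ncIota_legOp (c : ∀ n, Fin n → Equiv.Perm (Fin n) → ℚ) (hc : CompatDel c) (x : LegGrade)
    {n v : ℕ} (g : Fin (n + 1) → LegGrade) (P : Pairing (HalfEdge Empty (n + 1) v)) :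
    ncIota (legOp Empty c x (ncMk ⟨n + 1, g, v, P⟩))
      + legOp Unit c x (ncIota (ncMk ⟨n + 1, g, v, P⟩))
      = ∑ i, if x = LegGrade.one then permSum c i g (forkPairing P i) else
        if g i = LegGrade.two then ∑ σ, c (n + 1) i σ •
          signedPerm (g ∘ i.succAbove) (P.map (specialEquiv v i)) (delPerm σ i) else 0 := by
  rw [ncIota_ncMk_succ, legOp_ncMk, map_sum, map_sum]
  simp only [apply_ite ncIota, apply_ite (legOp Unit c x), map_zero, map_smul,
    ncIota_permSum, legOp_ncMk]
  have h : ∀ (a : ℚ) (Q : Prop) [Decidable Q] (F : Fin (n + 1) → NCWeil Unit),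
      (if Q then a • ∑ i, F i else 0) = ∑ i, if Q then a • F i else 0 := by
    intro a Q _ F
    split_ifs
    · exact Finset.smul_sum
    · simp
  simp only [h]
  rw [Finset.sum_comm, ← Finset.sum_add_distrib]
  refine Finset.sum_congr rfl fun i _ => ?_
  have hL : ∀ (g' : Fin (n + 1) → LegGrade) (y : LegGrade),
      legSign (Function.update g' i y) i = legSign g' i := fun g' y => by
    simp [legSign_update]
  have hflip : ∀ j, g j = x → legSign (Function.update g j x.flip) i
      = (if j < i then -1 else 1) * legSign g i := by
    rintro j rfl
    exact legSign_flip g j i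
  have hu : Function.update g i (g i) = g := Function.update_eq_self i g
  rw [Fin.sum_univ_succAbove _ i]
  -- The leg `i` is the one on which `ι` acts; the other operation acts on `i` itself or on some leg
  -- `i.succAbove j`.
  cases hi : g i with
  | one =>
    simp only [if_true]
    rw [add_assoc, Finset.smul_sum, ← Finset.sum_add_distrib]
    refine (congrArg₂ (· + ·) ?_ (Finset.sum_eq_zero ?_)).trans (add_zero _)
    · rw [hi] at hu
      cases x <;> simp [LegGrade.flip, hL, smul_smul, legSign_mul_self, hu]
    · intro j _
      by_cases hj : g (i.succAbove j) = x
      · simp only [hj, if_true, Function.comp_apply]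
        rw [Function.update_of_ne (Fin.succAbove_ne i j).symm, hi, if_pos rfl, hc,
          update_comp_succAbove, ← permSum, smul_smul, smul_smul, ← add_smul, hflip _ hj,
          legSign_succAbove, hi]
        convert zero_smul ℚ _ using 2
        rcases lt_or_gt_of_ne (Fin.succAbove_ne i j) with h | h
        · simp only [h, h.not_gt, if_true, if_false]
          ring
        · simp only [h, h.not_gt, if_true, if_false, LegGrade.val]
          ring
      · simp [hj]
  | two =>
    simp only [reduceCtorEq, if_false, if_true]
    rw [Fin.sum_univ_succAbove _ i, smul_add, add_add_add_comm, Finset.smul_sum,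
      ← Finset.sum_add_distrib]
    refine (congrArg₂ (· + ·) ?_ (Finset.sum_eq_zero ?_)).trans (add_zero _)
    · rw [hi] at hu
      cases x <;>
        simp [LegGrade.flip, hL, smul_smul, legSign_mul_self, hu, update_self_comp_succAbove]
    · intro j _
      by_cases hj : g (i.succAbove j) = x
      · simp only [hj, if_true, Function.update_of_ne (Fin.succAbove_ne i j)]
        rw [Function.update_of_ne (Fin.succAbove_ne i j).symm, hi, if_neg (by simp),
          smul_smul, smul_smul, Function.update_comm (Fin.succAbove_ne i j), ← add_smul,
          hflip _ hj, legSign_update, hi]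
        convert zero_smul ℚ _ using 2
        rcases lt_or_gt_of_ne (Fin.succAbove_ne i j) with h | h
        · simp only [h, h.not_gt, if_true, if_false]
          ring
        · simp only [h, h.not_gt, if_true, if_false, LegGrade.val]
          ring
      · simp [hj]

/-! ### The laws of the complex -/

theorem ncD_mem {S : Type} (i : ℤ) (x : NCWeil S) (hx : x ∈ ncGr S i) :
    ncD S x ∈ ncGr S (i + 1) := by
  rw [ncD_eq_legOp]
  exact legOp_mem trivCoeff LegGrade.one i x hx

theorem ncIota_mem (i : ℤ) (x : NCWeil Empty) (hx : x ∈ ncGr Empty i) :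
    ncIota x ∈ ncGr Unit (i - 1) := by
  refine mem_ncGr_of_ncMk ncIota (-1) (fun D => ?_) i x hx
  obtain ⟨n, g, v, P⟩ := D
  cases n with
  | zero => exact (ncIota_ncMk _).symm ▸ Submodule.zero_mem _
  | succ n =>
    rw [ncIota_ncMk_succ]
    refine Submodule.sum_mem _ fun i _ => Submodule.smul_mem _ _ ?_
    split_ifs with h
    · refine Submodule.subset_span ⟨_, ?_, rfl⟩
      simp only [WeilDiagram.legGrade]
      rw [Fin.sum_univ_succAbove (fun j => (g j).val) i, h]
      simp [LegGrade.val]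
    · refine Submodule.subset_span ⟨_, ?_, rfl⟩
      have h2 := sum_update_val g i LegGrade.one
      have h3 : g i = LegGrade.two := by
        cases hi : g i
        · exact absurd hi h
        · rfl
      rw [h3] at h2
      simp only [WeilDiagram.legGrade, LegGrade.val] at h2 ⊢
      omega

theorem ncD_ncD (S : Type) : ncD S ∘ₗ ncD S = 0 := by
  refine ncWeil_hom_ext fun D => ?_
  obtain ⟨n, g, v, P⟩ := D
  have h := ncD_legOp trivCoeff LegGrade.one g P
  rw [← ncD_eq_legOp, if_neg (by simp)] at h
  exact eq_zero_of_eq_neg (eq_neg_of_add_eq_zero_left h)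

theorem compatDel_trivCoeff : CompatDel trivCoeff := by
  intro n i j F
  simp [trivCoeff, delPerm_one]

/-- The differential anticommutes with `ι`. The surviving terms attach the special vertex to each
of the legs in turn. -/
theorem ncIota_ncD : ncIota ∘ₗ ncD Empty = -(ncD Unit ∘ₗ ncIota) := by
  refine ncWeil_hom_ext fun D => eq_neg_of_add_eq_zero_left ?_
  obtain ⟨n, g, v, P⟩ := D
  cases n with
  | zero =>
    have h1 : ncD Empty (ncMk ⟨0, g, v, P⟩) = 0 := (ncD_ncMk _).trans (by simp [dGen])
    have h2 : ncIota (ncMk ⟨0, g, v, P⟩) = 0 := ncIota_ncMk _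
    simp [h1, h2]
  | succ n =>
    have h := ncIota_legOp trivCoeff compatDel_trivCoeff LegGrade.one g P
    rw [← ncD_eq_legOp, ← ncD_eq_legOp] at h
    refine h.trans ?_
    simp only [if_true, permSum_trivCoeff]
    exact sum_attachMk_legs g P

theorem isIotaComplex_ncWeil : IsIotaComplex ncWeil where
  internal := ncGr_isInternal Empty
  internal_ι := ncGr_isInternal Unit
  gr_neg := ncGr_neg
  grι_neg := ncGr_neg
  d_mem := ncD_mem
  dι_mem := ncD_mem
  ι_mem := ncIota_mem
  d_d := ncD_ncD Empty
  dι_dι := ncD_ncD Unit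
  ι_d := ncIota_ncD

/-! ### Graded averaging -/

theorem chi_tau_ncMk_eq {S : Type} {n v : ℕ} (g : Fin n → LegGrade)
    (P : Pairing (HalfEdge S n v)) :
    chi S (tau S (ncMk ⟨n, g, v, P⟩)) = (1 / (n.factorial : ℚ)) • ∑ σ, signedPerm g P σ :=
  chi_tau_ncMk _

theorem chi_tau_mem {S : Type} (i : ℤ) (x : NCWeil S) (hx : x ∈ ncGr S i) :
    (chi S ∘ₗ tau S) x ∈ ncGr S i := by
  rw [← add_zero i]
  refine mem_ncGr_of_ncMk (chi S ∘ₗ tau S) 0 (fun D => ?_) i x hx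
  obtain ⟨n, g, v, P⟩ := D
  rw [LinearMap.comp_apply, chi_tau_ncMk_eq]
  exact Submodule.smul_mem _ _ (Submodule.sum_mem _ fun σ _ => signedPerm_mem g P σ _ (by
    simp [WeilDiagram.legGrade]))

theorem chi_tau_ncD (S : Type) :
    (chi S ∘ₗ tau S) ∘ₗ ncD S = ncD S ∘ₗ (chi S ∘ₗ tau S) := by
  refine ncWeil_hom_ext fun D => ?_
  obtain ⟨n, g, v, P⟩ := D
  simp only [LinearMap.comp_apply]
  rw [chi_tau_ncMk_eq, map_smul, map_sum, ← signedPerm_one, ncD_signedPerm, map_sum, map_sum]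
  simp only [ncD_signedPerm, signedPerm_one]
  rw [Finset.sum_comm, Finset.smul_sum]
  refine Finset.sum_congr rfl fun i _ => ?_
  split_ifs
  · rw [map_smul, map_smul, chi_tau_ncMk_eq, ← Finset.smul_sum, smul_comm]
  · simp

theorem chi_tau_ncIota :
    (chi Unit ∘ₗ tau Unit) ∘ₗ ncIota = ncIota ∘ₗ (chi Empty ∘ₗ tau Empty) := by
  refine ncWeil_hom_ext fun D => ?_
  obtain ⟨n, g, v, P⟩ := D
  simp only [LinearMap.comp_apply]
  rw [chi_tau_ncMk_eq, map_smul, map_sum]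
  cases n with
  | zero =>
    have h2 : ncIota (ncMk ⟨0, g, v, P⟩) = 0 := ncIota_ncMk _
    simp [h2, ncIota_signedPerm_zero]
  | succ n =>
    rw [ncIota_ncMk_succ, map_sum, map_sum]
    simp only [ncIota_signedPerm]
    rw [Finset.sum_comm, Finset.smul_sum]
    refine Finset.sum_congr rfl fun i _ => ?_
    rw [map_smul, map_smul, ← Finset.smul_sum, smul_comm]
    congr 1
    split_ifs
    · rw [chi_tau_ncMk_eq, average_delPerm i (fun ρ => signedPerm (g ∘ i.succAbove)
        (P.map (specialEquiv v i)) ρ)]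
    · rw [chi_tau_ncMk_eq]

theorem isIotaMap_chi_tau :
    IsIotaMap ncWeil ncWeil (chi Empty ∘ₗ tau Empty) (chi Unit ∘ₗ tau Unit) where
  f_mem := chi_tau_mem
  fι_mem := chi_tau_mem
  f_d := chi_tau_ncD Empty
  fι_dι := chi_tau_ncD Unit
  fι_ι := chi_tau_ncIota

/-! ### The homotopy -/

/-- The coefficients of the homotopy: in a random sequence `π` of jumps of the legs to the right
end of the orienting line, the rearrangement before the jump of the leg `j`, minus the rearrangement
after it. -/
def jumpCoeff (n : ℕ) (j : Fin n) (σ : Equiv.Perm (Fin n)) : ℚ :=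
  (1 / (n.factorial : ℚ)) * ∑ π : Equiv.Perm (Fin n),
    ((if σ = jumpPerm π (π j) then 1 else 0) - (if σ = jumpPerm π (π j + 1) then 1 else 0))

theorem sum_jumpCoeff {n : ℕ} (j : Fin n) {M : Type*} [AddCommGroup M] [Module ℚ M]
    (F : Equiv.Perm (Fin n) → M) :
    ∑ σ, jumpCoeff n j σ • F σ = (1 / (n.factorial : ℚ)) • ∑ π : Equiv.Perm (Fin n),
      (F (jumpPerm π (π j)) - F (jumpPerm π (π j + 1))) := by
  simp only [jumpCoeff, mul_smul, Finset.sum_smul, sub_smul, ite_smul, one_smul, zero_smul]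
  rw [← Finset.smul_sum, Finset.sum_comm]
  simp

theorem compatDel_jumpCoeff : CompatDel jumpCoeff := by
  intro n i j F
  rw [sum_jumpCoeff _ (fun σ => F (delPerm σ i)), sum_jumpCoeff]
  simp only [delPerm_jumpPerm_before, delPerm_jumpPerm_after]
  exact average_delPerm i
    (fun ρ => F (jumpPerm ρ (ρ j)) - F (jumpPerm ρ (ρ j + 1)))

theorem sum_jumpCoeff_delPerm {n : ℕ} (i : Fin (n + 1)) {M : Type*} [AddCommGroup M] [Module ℚ M]
    (F : Equiv.Perm (Fin n) → M) : ∑ σ, jumpCoeff (n + 1) i σ • F (delPerm σ i) = 0 := by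
  rw [sum_jumpCoeff]
  simp [delPerm_jumpPerm_self]

/-- The homotopy between the identity and graded averaging: a leg of grade 2 is given grade 1 at the
moment when it jumps. -/
def homotopy (S : Type) : NCWeil S →ₗ[ℚ] NCWeil S := legOp S jumpCoeff LegGrade.two

theorem homotopy_mem {S : Type} (i : ℤ) (x : NCWeil S) (hx : x ∈ ncGr S i) :
    homotopy S x ∈ ncGr S (i - 1) :=
  legOp_mem jumpCoeff LegGrade.two i x hx

theorem ncD_homotopy (S : Type) :
    ncD S ∘ₗ homotopy S + homotopy S ∘ₗ ncD S = LinearMap.id - chi S ∘ₗ tau S := by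
  refine ncWeil_hom_ext fun D => ?_
  obtain ⟨n, g, v, P⟩ := D
  refine (ncD_legOp jumpCoeff LegGrade.two g P).trans ?_
  simp only [if_true, permSum, LinearMap.sub_apply, LinearMap.id_apply, LinearMap.comp_apply]
  simp only [sum_jumpCoeff]
  rw [← Finset.smul_sum, Finset.sum_comm, chi_tau_ncMk_eq]
  simp only [sum_jumpPerm, signedPerm_one]
  rw [Finset.sum_sub_distrib, smul_sub]
  congr 1
  have : (n.factorial : ℚ) ≠ 0 := by positivity
  rw [Finset.sum_const, Finset.card_univ, Fintype.card_perm, Fintype.card_fin,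
    ← Nat.cast_smul_eq_nsmul ℚ, smul_smul, one_div_mul_cancel this, one_smul]

theorem homotopy_ncIota : homotopy Unit ∘ₗ ncIota + ncIota ∘ₗ homotopy Empty = 0 := by
  refine ncWeil_hom_ext fun D => ?_
  rw [add_comm]
  obtain ⟨n, g, v, P⟩ := D
  cases n with
  | zero =>
    have h1 : homotopy Empty (ncMk ⟨0, g, v, P⟩) = 0 := (legOp_ncMk _ _ _ _).trans (by simp)
    have h2 : ncIota (ncMk ⟨0, g, v, P⟩) = 0 := ncIota_ncMk _
    simp [h1, h2]
  | succ n =>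
    refine (ncIota_legOp jumpCoeff compatDel_jumpCoeff LegGrade.two g P).trans ?_
    refine Finset.sum_eq_zero fun i _ => ?_
    rw [if_neg (by simp), sum_jumpCoeff_delPerm i (fun ρ => signedPerm (g ∘ i.succAbove)
      (P.map (specialEquiv v i)) ρ), ite_self]

theorem isIotaHomotopy_homotopy :
    IsIotaHomotopy ncWeil ncWeil LinearMap.id LinearMap.id (chi Empty ∘ₗ tau Empty)
      (chi Unit ∘ₗ tau Unit) (homotopy Empty) (homotopy Unit) where
  s_mem := homotopy_mem
  sι_mem := homotopy_mem
  homotopy := ncD_homotopy Empty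
  homotopy_ι := ncD_homotopy Unit
  sι_ι := homotopy_ncIota

section

variable {K Kι L Lι : Type} [AddCommGroup K] [Module ℚ K] [AddCommGroup Kι] [Module ℚ Kι]
  [AddCommGroup L] [Module ℚ L] [AddCommGroup Lι] [Module ℚ Lι]
  {X : IotaData K Kι} {Y : IotaData L Lι}

theorem IsIotaMap.mem_basicCocycles {f : K →ₗ[ℚ] L} {fι : Kι →ₗ[ℚ] Lι} (h : IsIotaMap X Y f fι)
    {i : ℤ} {z : K} (hz : z ∈ X.basicCocycles i) : f z ∈ Y.basicCocycles i := by
  obtain ⟨⟨hi, hι⟩, hd⟩ := hz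
  have hι' : X.ι z = 0 := hι
  have hd' : X.d z = 0 := hd
  refine ⟨⟨h.f_mem i z hi, ?_⟩, ?_⟩
  · simpa [hι'] using (LinearMap.congr_fun h.fι_ι z).symm
  · simpa [hd'] using (LinearMap.congr_fun h.f_d z).symm

theorem IsIotaHomotopy.sub_mem_basicCoboundaries {f g s : K →ₗ[ℚ] L} {fι gι sι : Kι →ₗ[ℚ] Lι}
    (h : IsIotaHomotopy X Y f fι g gι s sι) {i : ℤ} {z : K} (hz : z ∈ X.basicCocycles i) :
    f z - g z ∈ Y.basicCoboundaries i := by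
  obtain ⟨⟨hi, hι⟩, hd⟩ := hz
  have hι' : X.ι z = 0 := hι
  have hd' : X.d z = 0 := hd
  refine ⟨s z, ⟨h.s_mem i z hi, ?_⟩, ?_⟩
  · simpa [hι'] using LinearMap.congr_fun h.sι_ι z
  · simpa [hd'] using LinearMap.congr_fun h.homotopy z

end

end Weil

end

theorem mainTheorem2 :
    Weil.IsIotaComplex Weil.ncWeil ∧
    Weil.IsIotaMap Weil.ncWeil Weil.ncWeil LinearMap.id LinearMap.id ∧
    Weil.IsIotaMap Weil.ncWeil Weil.ncWeil
      (Weil.chi Empty ∘ₗ Weil.tau Empty) (Weil.chi Unit ∘ₗ Weil.tau Unit) ∧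
    (∃ (s : Weil.NCWeil Empty →ₗ[ℚ] Weil.NCWeil Empty)
        (sι : Weil.NCWeil Unit →ₗ[ℚ] Weil.NCWeil Unit),
      Weil.IsIotaHomotopy Weil.ncWeil Weil.ncWeil LinearMap.id LinearMap.id
        (Weil.chi Empty ∘ₗ Weil.tau Empty) (Weil.chi Unit ∘ₗ Weil.tau Unit) s sι) ∧
    (∀ (i : ℤ), ∀ z ∈ Weil.ncWeil.basicCocycles i,
      Weil.chi Empty (Weil.tau Empty z) ∈ Weil.ncWeil.basicCocycles i ∧
      z - Weil.chi Empty (Weil.tau Empty z) ∈ Weil.ncWeil.basicCoboundaries i) :=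
  ⟨Weil.isIotaComplex_ncWeil,
    ⟨fun _ _ h => h, fun _ _ h => h, rfl, rfl, rfl⟩,
    Weil.isIotaMap_chi_tau,
    ⟨_, _, Weil.isIotaHomotopy_homotopy⟩,
    fun _ _ hz => ⟨Weil.isIotaMap_chi_tau.mem_basicCocycles hz,
      Weil.isIotaHomotopy_homotopy.sub_mem_basicCoboundaries hz⟩⟩
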